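/- Let $\Sigma$ be a linear-time vocabulary: a many-typed first-order vocabulary with a type $\mathit{Time}$ (interpreted as $\mathbb N$), a constant $\mathcal I$ of type $\mathit{Time}$ (interpreted as $0$) and a function $\mathcal S:\mathit{Time}\to\mathit{Time}$ (the successor), in which every other symbol has at most one argument of type $\mathit{Time}$ (its last one) and no other function has output type $\mathit{Time}$. Symbols without $\mathit{Time}$ argument are static, the other symbols (except $\mathcal I,\mathcal S$) are dynamic. A state is a structure interpreting (over nonempty domains for the types other than $\mathit{Time}$) the static symbols and, for each dynamic symbol, the symbol obtained by dropping its $\mathit{Time}$ argument. A $k$-chain is a sequence $I=(I_0,\dots,I_k)$ of states with the same domains and the same static symbols; a $\Sigma$-structure is identified with an infinite such sequence. For a state $S$ sharing the domains and static symbols of $I$, $I{::}S$ is the $(k+1)$-chain $(I_0,\dots,I_k,S)$. A theory $\mathcal T$ consists of a set of first-order sentences and a definition $\Delta$, a set of rules $\forall\bar x: P(\bar t)\leftarrow\varphi$ or $\forall\bar x: f(\bar t)=t'\leftarrow\varphi$ interpreted by the well-founded semantics (functions through their graphs; a structure satisfies $\Delta$ if it is the well-founded model of $\Delta$ extending its interpretation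 of the symbols that occur in no head). $\mathcal T$ is an LTC-theory if (i) each of its sentences and rules either contains no term of type $\mathit{Time}$, or contains $\mathcal I$ and no other term of type $\mathit{Time}$, or is of the form $\forall t:\varphi'$ (up to further universal quantifiers over other types in front) with $t$ a $\mathit{Time}$ variable not quantified in $\varphi'$ and all terms of type $\mathit{Time}$ among $t,\mathcal S(t)$; and (ii) $\Delta$ is stratified over $\mathit{Time}$: no rule defines an atom in terms of dynamic symbols at a later time point, where static atoms count as belonging to time $0$. A $k$-chain $I$ is $\mathcal T$-compatible if some model of $\mathcal T$ extends it. It is weakly $\mathcal T$-compatible if $\mathcal T$ does not have Kleene value false in the three-valued structure that agrees with $I$ on static symbols and on times $\le k$ and leaves every dynamic symbol unknown at times $>k$. Here sentences are evaluated by the Kleene truth tables, an atom containing function terms being read through the graphs of the functions ($P(f(x))$ as $\exists y\,(f(x)=y\wedge P(y))$); the definition has value true if all its defined atoms are two-valued and the structure is the well-founded model extending its open part, value false if some defined atom is interpreted incorrectly (it has a truth value, true or false, that the well-founded semantics gives it under no two-valued completion of the open symbols), and value unknown otherwise; $\mathcal T$ has value false if one of its sentences or its definition has value false. A state $S$ is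 a (weak) $\mathcal T$-successor of $I$ if $I{::}S$ is defined and (weakly) $\mathcal T$-compatible. Then every LTC-theory $\mathcal T$ satisfies: 1. (Markov property) for all $k,k'$, every $\mathcal T$-compatible $k$-chain $I$ and every $\mathcal T$-compatible $k'$-chain $I'$ with $I_k=I'_{k'}$, the $\mathcal T$-successors of $I$ are exactly the $\mathcal T$-successors of $I'$; 2. (weak Markov property) for all $k,k'$, every weakly $\mathcal T$-compatible $k$-chain $I$ and every weakly $\mathcal T$-compatible $k'$-chain $I'$ with $I_k=I'_{k'}$, the weak $\mathcal T$-successors of $I$ are exactly the weak $\mathcal T$-successors of $I'$. -/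

import Mathlib

universe u v

namespace LTC

/-! ## Truth values -/

/-- The three truth values, ordered by truth: `fls < unk < tru`. -/
inductive TV : Type
  | fls
  | unk
  | tru
  deriving DecidableEq

namespace TV

/-- Rank of a truth value in the truth order. -/
def rank : TV → Fin 3
  | fls => 0
  | unk => 1
  | tru => 2

theorem rank_injective : Function.Injective rank := by
  intro a b h
  cases a <;> cases b <;> simp_all [rank]

instance : Fintype TV := ⟨{fls, unk, tru}, fun a => by cases a <;> simp⟩

instance : Nonempty TV := ⟨unk⟩

instance : LinearOrder TV := LinearOrder.lift' rank rank_injective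

/-- Least upper bounds are maxima and greatest lower bounds are minima in the truth order. -/
noncomputable instance : CompleteLinearOrder TV := Fintype.toCompleteLinearOrderOfNonempty TV

/-- Kleene negation. -/
def neg : TV → TV
  | fls => tru
  | unk => unk
  | tru => fls

/-- The precision order: `unk` is below everything, `fls` and `tru` are maximal. -/
def Prec (a b : TV) : Prop := a = unk ∨ a = b

open Classical in
/-- The two-valued truth value of a proposition. -/
noncomputable def ofProp (p : Prop) : TV := if p then tru else fls

end TV

/-! ## Vocabularies and syntax -/

/-- A linear-time vocabulary. `Ty` is the collection of types other than `Time`.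
The type `Time`, the constant `𝓘 : Time` and the function `𝓢 : Time → Time` are built into the
syntax below. Static symbols have no `Time` argument; dynamic symbols have exactly one `Time`
argument, in the last position, which is not listed among `dPredArg`, `dFunArg`. No other function
symbol has output type `Time`. -/
structure Vocabulary : Type (u + 1) where
  Ty : Type u
  SPred : Type u
  sPredArity : SPred → ℕ
  sPredArg : (p : SPred) → Fin (sPredArity p) → Ty
  DPred : Type u
  dPredArity : DPred → ℕ
  dPredArg : (p : DPred) → Fin (dPredArity p) → Ty
  SFun : Type u
  sFunArity : SFun → ℕ
  sFunArg : (f : SFun) → Fin (sFunArity f) → Ty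
  sFunOut : SFun → Ty
  DFun : Type u
  dFunArity : DFun → ℕ
  dFunArg : (f : DFun) → Fin (dFunArity f) → Ty
  dFunOut : DFun → Ty

/-- Terms of type `Time`. -/
inductive TimeTerm : Type
  | var (x : ℕ)
  | init
  | succ (t : TimeTerm)

/-- Terms of a type other than `Time`. -/
inductive ObjTerm (V : Vocabulary.{u}) : V.Ty → Type u
  | var (τ : V.Ty) (x : ℕ) : ObjTerm V τ
  | sfun (f : V.SFun) (args : ∀ i, ObjTerm V (V.sFunArg f i)) : ObjTerm V (V.sFunOut f)
  | dfun (f : V.DFun) (args : ∀ i, ObjTerm V (V.dFunArg f i)) (t : TimeTerm) :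
      ObjTerm V (V.dFunOut f)

/-- First-order formulas. The suffixes `O` and `T` distinguish equality and quantification over
an ordinary type from equality and quantification over `Time`. -/
inductive Formula (V : Vocabulary.{u}) : Type u
  | top : Formula V
  | spred (p : V.SPred) (args : ∀ i, ObjTerm V (V.sPredArg p i)) : Formula V
  | dpred (p : V.DPred) (args : ∀ i, ObjTerm V (V.dPredArg p i)) (t : TimeTerm) : Formula V
  | eqO (τ : V.Ty) (a b : ObjTerm V τ) : Formula V
  | eqT (a b : TimeTerm) : Formula V
  | neg (φ : Formula V) : Formula V
  | and (φ ψ : Formula V) : Formula V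
  | or (φ ψ : Formula V) : Formula V
  | allO (τ : V.Ty) (x : ℕ) (φ : Formula V) : Formula V
  | exO (τ : V.Ty) (x : ℕ) (φ : Formula V) : Formula V
  | allT (x : ℕ) (φ : Formula V) : Formula V
  | exT (x : ℕ) (φ : Formula V) : Formula V

/-- Heads of rules: `P(args)`, `P(args, t)`, `f(args) = v` or `f(args, t) = v`. -/
inductive Head (V : Vocabulary.{u}) : Type u
  | spred (p : V.SPred) (args : ∀ i, ObjTerm V (V.sPredArg p i)) : Head V
  | dpred (p : V.DPred) (args : ∀ i, ObjTerm V (V.dPredArg p i)) (t : TimeTerm) : Head V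
  | sfun (f : V.SFun) (args : ∀ i, ObjTerm V (V.sFunArg f i))
      (v : ObjTerm V (V.sFunOut f)) : Head V
  | dfun (f : V.DFun) (args : ∀ i, ObjTerm V (V.dFunArg f i)) (t : TimeTerm)
      (v : ObjTerm V (V.dFunOut f)) : Head V

/-- A rule `∀ x̄ : head ← body`; all variables that are free in the head or the body are
universally quantified in front of the rule. -/
structure Rule (V : Vocabulary.{u}) : Type u where
  head : Head V
  body : Formula V

/-- The predicate and function symbols of the vocabulary. -/
inductive Sym (V : Vocabulary.{u}) : Type u
  | spred (p : V.SPred)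
  | dpred (p : V.DPred)
  | sfun (f : V.SFun)
  | dfun (f : V.DFun)

/-- The symbol in the head of a rule. -/
def Head.sym {V : Vocabulary.{u}} : Head V → Sym V
  | .spred p _ => .spred p
  | .dpred p _ _ => .dpred p
  | .sfun f _ _ => .sfun f
  | .dfun f _ _ _ => .dfun f

/-! ### Free variables -/

/-- The `Time` variables of a term of type `Time`. -/
def TimeTerm.vars : TimeTerm → Set ℕ
  | .var x => {x}
  | .init => ∅
  | .succ t => t.vars

/-- The `Time` variables of a term. -/
def ObjTerm.timeVars {V : Vocabulary.{u}} : {τ : V.Ty} → ObjTerm V τ → Set ℕ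
  | _, .var _ _ => ∅
  | _, .sfun _ args => ⋃ i, (args i).timeVars
  | _, .dfun _ args t => (⋃ i, (args i).timeVars) ∪ t.vars

/-- The variables of a term that are not of type `Time`. -/
def ObjTerm.objVars {V : Vocabulary.{u}} : {τ : V.Ty} → ObjTerm V τ → Set (V.Ty × ℕ)
  | _, .var τ x => {(τ, x)}
  | _, .sfun _ args => ⋃ i, (args i).objVars
  | _, .dfun _ args _ => ⋃ i, (args i).objVars

/-- The free `Time` variables of a formula. -/
def Formula.freeTime {V : Vocabulary.{u}} : Formula V → Set ℕ
  | .top => ∅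
  | .spred _ args => ⋃ i, (args i).timeVars
  | .dpred _ args t => (⋃ i, (args i).timeVars) ∪ t.vars
  | .eqO _ a b => a.timeVars ∪ b.timeVars
  | .eqT a b => a.vars ∪ b.vars
  | .neg φ => φ.freeTime
  | .and φ ψ => φ.freeTime ∪ ψ.freeTime
  | .or φ ψ => φ.freeTime ∪ ψ.freeTime
  | .allO _ _ φ => φ.freeTime
  | .exO _ _ φ => φ.freeTime
  | .allT x φ => φ.freeTime \ {x}
  | .exT x φ => φ.freeTime \ {x}

/-- The free variables of a formula that are not of type `Time`. -/
def Formula.freeObj {V : Vocabulary.{u}} : Formula V → Set (V.Ty × ℕ)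
  | .top => ∅
  | .spred _ args => ⋃ i, (args i).objVars
  | .dpred _ args _ => ⋃ i, (args i).objVars
  | .eqO _ a b => a.objVars ∪ b.objVars
  | .eqT _ _ => ∅
  | .neg φ => φ.freeObj
  | .and φ ψ => φ.freeObj ∪ ψ.freeObj
  | .or φ ψ => φ.freeObj ∪ ψ.freeObj
  | .allO τ x φ => φ.freeObj \ {(τ, x)}
  | .exO τ x φ => φ.freeObj \ {(τ, x)}
  | .allT _ φ => φ.freeObj
  | .exT _ φ => φ.freeObj

/-- A sentence is a formula without free variables. -/
def Formula.IsSentence {V : Vocabulary.{u}} (φ : Formula V) : Prop :=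
  φ.freeTime = ∅ ∧ φ.freeObj = ∅

/-- An FO(ID) theory: a set of sentences and one (possibly empty) definition, a set of rules. -/
structure Theory (V : Vocabulary.{u}) : Type u where
  sentences : Set (Formula V)
  rules : Set (Rule V)
  isSentence : ∀ φ ∈ sentences, φ.IsSentence

/-! ### The syntactic restrictions of LTC -/

/-- The terms of type `Time` that occur in a term of type `Time`. -/
def TimeTerm.subterms : TimeTerm → Set TimeTerm
  | .var x => {.var x}
  | .init => {.init}
  | .succ t => {.succ t} ∪ t.subterms

/-- The terms of type `Time` that occur in a term. -/
def ObjTerm.timeTerms {V : Vocabulary.{u}} : {τ : V.Ty} → ObjTerm V τ → Set TimeTerm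
  | _, .var _ _ => ∅
  | _, .sfun _ args => ⋃ i, (args i).timeTerms
  | _, .dfun _ args t => (⋃ i, (args i).timeTerms) ∪ t.subterms

/-- The terms of type `Time` that occur in a formula, quantified variables included. -/
def Formula.timeTerms {V : Vocabulary.{u}} : Formula V → Set TimeTerm
  | .top => ∅
  | .spred _ args => ⋃ i, (args i).timeTerms
  | .dpred _ args t => (⋃ i, (args i).timeTerms) ∪ t.subterms
  | .eqO _ a b => a.timeTerms ∪ b.timeTerms
  | .eqT a b => a.subterms ∪ b.subterms
  | .neg φ => φ.timeTerms
  | .and φ ψ => φ.timeTerms ∪ ψ.timeTerms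
  | .or φ ψ => φ.timeTerms ∪ ψ.timeTerms
  | .allO _ _ φ => φ.timeTerms
  | .exO _ _ φ => φ.timeTerms
  | .allT x φ => {.var x} ∪ φ.timeTerms
  | .exT x φ => {.var x} ∪ φ.timeTerms

/-- The terms of type `Time` that occur in the head of a rule. -/
def Head.timeTerms {V : Vocabulary.{u}} : Head V → Set TimeTerm
  | .spred _ args => ⋃ i, (args i).timeTerms
  | .dpred _ args t => (⋃ i, (args i).timeTerms) ∪ t.subterms
  | .sfun _ args v => (⋃ i, (args i).timeTerms) ∪ v.timeTerms
  | .dfun _ args t v => (⋃ i, (args i).timeTerms) ∪ t.subterms ∪ v.timeTerms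

/-- The terms of type `Time` that occur in a rule. -/
def Rule.timeTerms {V : Vocabulary.{u}} (r : Rule V) : Set TimeTerm :=
  r.head.timeTerms ∪ r.body.timeTerms

/-- The `Time` variable `x` is quantified somewhere in the formula. -/
def Formula.QuantifiesTime {V : Vocabulary.{u}} (x : ℕ) : Formula V → Prop
  | .top => False
  | .spred _ _ => False
  | .dpred _ _ _ => False
  | .eqO _ _ _ => False
  | .eqT _ _ => False
  | .neg φ => φ.QuantifiesTime x
  | .and φ ψ => φ.QuantifiesTime x ∨ ψ.QuantifiesTime x
  | .or φ ψ => φ.QuantifiesTime x ∨ ψ.QuantifiesTime x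
  | .allO _ _ φ => φ.QuantifiesTime x
  | .exO _ _ φ => φ.QuantifiesTime x
  | .allT y φ => y = x ∨ φ.QuantifiesTime x
  | .exT y φ => y = x ∨ φ.QuantifiesTime x

/-- The formula is `∀ t : φ'` with the `Time` variable `t = x` not quantified in `φ'`. The
quantifier `∀ t` may be preceded by universal quantifiers over ordinary types, as in
`∀ a, t, d : φ'`. -/
inductive Formula.UniversalIn {V : Vocabulary.{u}} (x : ℕ) : Formula V → Prop
  | here (φ : Formula V) (h : ¬ φ.QuantifiesTime x) : Formula.UniversalIn x (.allT x φ)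
  | under (τ : V.Ty) (y : ℕ) (φ : Formula V) (h : Formula.UniversalIn x φ) :
      Formula.UniversalIn x (.allO τ y φ)

/-- The terms of type `Time` in `s` are exactly one variable `x`. -/
def SingleStateIn (x : ℕ) (s : Set TimeTerm) : Prop := s = {.var x}

/-- The terms of type `Time` in `s` are a variable `x`, and possibly `𝓢(x)`. -/
def BistateIn (x : ℕ) (s : Set TimeTerm) : Prop :=
  .var x ∈ s ∧ s ⊆ {.var x, .succ (.var x)}

/-- Static, initial, universal single-state or universal bistate sentences. -/
def Formula.IsLTC {V : Vocabulary.{u}} (φ : Formula V) : Prop :=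
  φ.timeTerms = ∅ ∨ φ.timeTerms = {.init} ∨
    (∃ x, SingleStateIn x φ.timeTerms ∧ φ.UniversalIn x) ∨
    (∃ x, BistateIn x φ.timeTerms ∧ φ.UniversalIn x)

/-- Static, initial, universal single-state or universal bistate rules. The variables of a rule
are quantified in front of it, so a rule is universal when its `Time` variable is not quantified
in the body. -/
def Rule.IsLTC {V : Vocabulary.{u}} (r : Rule V) : Prop :=
  r.timeTerms = ∅ ∨ r.timeTerms = {.init} ∨
    (∃ x, SingleStateIn x r.timeTerms ∧ ¬ r.body.QuantifiesTime x) ∨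
    (∃ x, BistateIn x r.timeTerms ∧ ¬ r.body.QuantifiesTime x)

/-- The value of a term of type `Time`; `η` is the assignment of the `Time` variables. -/
def TimeTerm.val (η : ℕ → ℕ) : TimeTerm → ℕ
  | .var x => η x
  | .init => 0
  | .succ t => t.val η + 1

/-- The `Time` arguments of the dynamic function symbols in a term. -/
def ObjTerm.dynTimes {V : Vocabulary.{u}} : {τ : V.Ty} → ObjTerm V τ → Set TimeTerm
  | _, .var _ _ => ∅
  | _, .sfun _ args => ⋃ i, (args i).dynTimes
  | _, .dfun _ args t => (⋃ i, (args i).dynTimes) ∪ {t}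

/-- The `Time` arguments of the dynamic symbols in a formula. -/
def Formula.dynTimes {V : Vocabulary.{u}} : Formula V → Set TimeTerm
  | .top => ∅
  | .spred _ args => ⋃ i, (args i).dynTimes
  | .dpred _ args t => (⋃ i, (args i).dynTimes) ∪ {t}
  | .eqO _ a b => a.dynTimes ∪ b.dynTimes
  | .eqT _ _ => ∅
  | .neg φ => φ.dynTimes
  | .and φ ψ => φ.dynTimes ∪ ψ.dynTimes
  | .or φ ψ => φ.dynTimes ∪ ψ.dynTimes
  | .allO _ _ φ => φ.dynTimes
  | .exO _ _ φ => φ.dynTimes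
  | .allT _ φ => φ.dynTimes
  | .exT _ φ => φ.dynTimes

/-- The `Time` arguments of the dynamic symbols inside the terms of a head. -/
def Head.dynTimes {V : Vocabulary.{u}} : Head V → Set TimeTerm
  | .spred _ args => ⋃ i, (args i).dynTimes
  | .dpred _ args _ => ⋃ i, (args i).dynTimes
  | .sfun _ args v => (⋃ i, (args i).dynTimes) ∪ v.dynTimes
  | .dfun _ args _ v => (⋃ i, (args i).dynTimes) ∪ v.dynTimes

/-- The time point of the atom that a head defines; static atoms belong to time `0`, since they
are part of every state. -/
def Head.time {V : Vocabulary.{u}} (η : ℕ → ℕ) : Head V → ℕ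
  | .spred _ _ => 0
  | .dpred _ _ t => t.val η
  | .sfun _ _ _ => 0
  | .dfun _ _ t _ => t.val η

/-- A definition is stratified over `Time`: no rule defines an atom in terms of dynamic symbols at
a later time point. -/
def StratifiedOverTime {V : Vocabulary.{u}} (Δ : Set (Rule V)) : Prop :=
  ∀ r ∈ Δ, ∀ t ∈ r.head.dynTimes ∪ r.body.dynTimes, ∀ η : ℕ → ℕ, t.val η ≤ r.head.time η

/-- LTC-theories. -/
def Theory.IsLTC {V : Vocabulary.{u}} (T : Theory V) : Prop :=
  (∀ φ ∈ T.sentences, φ.IsLTC) ∧ (∀ r ∈ T.rules, r.IsLTC) ∧ StratifiedOverTime T.rules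

/-! ## Structures, states and chains -/

section Semantics

variable {V : Vocabulary.{u}}

/-- Interpretations of the static symbols over the domains `D`. -/
structure StatInterp (V : Vocabulary.{u}) (D : V.Ty → Type v) : Type (max u v) where
  pred : (p : V.SPred) → (∀ i, D (V.sPredArg p i)) → Prop
  func : (f : V.SFun) → (∀ i, D (V.sFunArg f i)) → D (V.sFunOut f)

/-- Interpretations, over the domains `D`, of the projected symbols of the dynamic symbols. -/
structure DynInterp (V : Vocabulary.{u}) (D : V.Ty → Type v) : Type (max u v) where
  pred : (p : V.DPred) → (∀ i, D (V.dPredArg p i)) → Prop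
  func : (f : V.DFun) → (∀ i, D (V.dFunArg f i)) → D (V.dFunOut f)

/-- Interpretations of all symbols over the domains `D`, with `Time` interpreted as `ℕ`. -/
structure Interp (V : Vocabulary.{u}) (D : V.Ty → Type v) : Type (max u v) where
  stat : StatInterp V D
  dynPred : (p : V.DPred) → (∀ i, D (V.dPredArg p i)) → ℕ → Prop
  dynFun : (f : V.DFun) → (∀ i, D (V.dFunArg f i)) → ℕ → D (V.dFunOut f)

/-- Structures over the linear-time vocabulary. -/
structure LTStructure (V : Vocabulary.{u}) : Type (max u (v + 1)) where
  dom : V.Ty → Type v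
  nonempty : ∀ τ, Nonempty (dom τ)
  interp : Interp V dom

/-- States: structures over the single-state vocabulary. -/
structure State (V : Vocabulary.{u}) : Type (max u (v + 1)) where
  dom : V.Ty → Type v
  nonempty : ∀ τ, Nonempty (dom τ)
  stat : StatInterp V dom
  dyn : DynInterp V dom

/-- `k`-chains: sequences of `k + 1` states that share the domains and the interpretation of the
static symbols. -/
structure Chain (V : Vocabulary.{u}) (k : ℕ) : Type (max u (v + 1)) where
  dom : V.Ty → Type v
  nonempty : ∀ τ, Nonempty (dom τ)
  stat : StatInterp V dom
  dyn : Fin (k + 1) → DynInterp V dom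

/-- The single-state projection of a structure on time `n`. -/
def LTStructure.state (M : LTStructure.{u, v} V) (n : ℕ) : State.{u, v} V where
  dom := M.dom
  nonempty := M.nonempty
  stat := M.interp.stat
  dyn := ⟨fun p d => M.interp.dynPred p d n, fun f d => M.interp.dynFun f d n⟩

/-- The states of a chain. -/
def Chain.state {k : ℕ} (I : Chain.{u, v} V k) (j : Fin (k + 1)) : State.{u, v} V where
  dom := I.dom
  nonempty := I.nonempty
  stat := I.stat
  dyn := I.dyn j

/-- The structure `M`, as an infinite chain, extends the `k`-chain `I`. -/
def LTStructure.Extends (M : LTStructure.{u, v} V) {k : ℕ} (I : Chain.{u, v} V k) : Prop :=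
  ∀ j : Fin (k + 1), M.state j = I.state j

/-- `J` is the direct extension of the `k`-chain `I` with the state `S`. It exists, and is then
unique, when `S` has the same domains and static symbols as `I`. -/
def IsDirectExtension {k : ℕ} (J : Chain.{u, v} V (k + 1)) (I : Chain.{u, v} V k)
    (S : State.{u, v} V) : Prop :=
  (∀ j : Fin (k + 1), J.state j.castSucc = I.state j) ∧ J.state (Fin.last (k + 1)) = S

/-! ## Two-valued satisfaction of formulas -/

open Classical in
/-- Changes the value of the variable `x` of type `τ` to `d`. -/
noncomputable def updateObj {D : V.Ty → Type v} (ρ : ∀ τ, ℕ → D τ) (τ : V.Ty) (x : ℕ) (d : D τ) :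
    ∀ τ, ℕ → D τ :=
  Function.update ρ τ (Function.update (ρ τ) x d)

/-- The value of a term. -/
def ObjTerm.eval {D : V.Ty → Type v} (M : Interp V D) (η : ℕ → ℕ) (ρ : ∀ τ, ℕ → D τ) :
    {τ : V.Ty} → ObjTerm V τ → D τ
  | _, .var τ x => ρ τ x
  | _, .sfun f args => M.stat.func f fun i => (args i).eval M η ρ
  | _, .dfun f args t => M.dynFun f (fun i => (args i).eval M η ρ) (t.val η)

/-- Satisfaction of a formula in an interpretation. -/
def Formula.Sat {D : V.Ty → Type v} (M : Interp V D) :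
    Formula V → (ℕ → ℕ) → (∀ τ, ℕ → D τ) → Prop
  | .top, _, _ => True
  | .spred p args, η, ρ => M.stat.pred p fun i => (args i).eval M η ρ
  | .dpred p args t, η, ρ => M.dynPred p (fun i => (args i).eval M η ρ) (t.val η)
  | .eqO _ a b, η, ρ => a.eval M η ρ = b.eval M η ρ
  | .eqT a b, η, _ => a.val η = b.val η
  | .neg φ, η, ρ => ¬ φ.Sat M η ρ
  | .and φ ψ, η, ρ => φ.Sat M η ρ ∧ ψ.Sat M η ρ
  | .or φ ψ, η, ρ => φ.Sat M η ρ ∨ ψ.Sat M η ρ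
  | .allO τ x φ, η, ρ => ∀ d : D τ, φ.Sat M η (updateObj ρ τ x d)
  | .exO τ x φ, η, ρ => ∃ d : D τ, φ.Sat M η (updateObj ρ τ x d)
  | .allT x φ, η, ρ => ∀ n : ℕ, φ.Sat M (Function.update η x n) ρ
  | .exT x φ, η, ρ => ∃ n : ℕ, φ.Sat M (Function.update η x n) ρ

/-! ## Partial structures and the Kleene valuation -/

/-- Domain atoms over `D`: atoms of predicate symbols, and atoms `f(d) = e` of the graphs of
function symbols. -/
inductive Atom (V : Vocabulary.{u}) (D : V.Ty → Type v) : Type (max u v)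
  | spred (p : V.SPred) (d : ∀ i, D (V.sPredArg p i))
  | dpred (p : V.DPred) (d : ∀ i, D (V.dPredArg p i)) (n : ℕ)
  | sfun (f : V.SFun) (d : ∀ i, D (V.sFunArg f i)) (e : D (V.sFunOut f))
  | dfun (f : V.DFun) (d : ∀ i, D (V.dFunArg f i)) (n : ℕ) (e : D (V.dFunOut f))

/-- The symbol of a domain atom. -/
def Atom.sym {D : V.Ty → Type v} : Atom V D → Sym V
  | .spred p _ => .spred p
  | .dpred p _ _ => .dpred p
  | .sfun f _ _ => .sfun f
  | .dfun f _ _ _ => .dfun f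

/-- Partial interpretations: partial sets for predicate symbols and for the graphs of function
symbols. -/
abbrev PInterp (V : Vocabulary.{u}) (D : V.Ty → Type v) : Type (max u v) := Atom V D → TV

/-- An interpretation as a (two-valued) partial interpretation. -/
noncomputable def Interp.toPartial {D : V.Ty → Type v} (M : Interp V D) : PInterp V D
  | .spred p d => TV.ofProp (M.stat.pred p d)
  | .dpred p d n => TV.ofProp (M.dynPred p d n)
  | .sfun f d e => TV.ofProp (M.stat.func f d = e)
  | .dfun f d n e => TV.ofProp (M.dynFun f d n = e)

/-- The partial interpretation of a `k`-chain: complete information on the static symbols and the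
time points up to `k`, and no information on later time points. -/
noncomputable def Chain.toPartial {k : ℕ} (I : Chain.{u, v} V k) : PInterp V I.dom
  | .spred p d => TV.ofProp (I.stat.pred p d)
  | .dpred p d n =>
      if h : n < k + 1 then TV.ofProp ((I.dyn ⟨n, h⟩).pred p d) else TV.unk
  | .sfun f d e => TV.ofProp (I.stat.func f d = e)
  | .dfun f d n e =>
      if h : n < k + 1 then TV.ofProp ((I.dyn ⟨n, h⟩).func f d = e) else TV.unk

/-- `a.klEq M η ρ d` is the truth value of `a = d` in the partial interpretation `M`, where nested
terms are read through graphs: `f(b) = d` is `∃ y : b = y ∧ Graph_f(y, d)`. -/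
noncomputable def ObjTerm.klEq {D : V.Ty → Type v} (M : PInterp V D) (η : ℕ → ℕ)
    (ρ : ∀ τ, ℕ → D τ) : {τ : V.Ty} → ObjTerm V τ → D τ → TV
  | _, .var τ x, d => TV.ofProp (ρ τ x = d)
  | _, .sfun f args, e => ⨆ d, (⨅ i, (args i).klEq M η ρ (d i)) ⊓ M (.sfun f d e)
  | _, .dfun f args t, e => ⨆ d, (⨅ i, (args i).klEq M η ρ (d i)) ⊓ M (.dfun f d (t.val η) e)

/-- The Kleene valuation of formulas. An atom `P(a)` is read as `∃ y : a = y ∧ P(y)`; this is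
`P` applied to the value of `a` whenever the value of `a` is known. -/
noncomputable def Formula.kl {D : V.Ty → Type v} (M : PInterp V D) :
    Formula V → (ℕ → ℕ) → (∀ τ, ℕ → D τ) → TV
  | .top, _, _ => TV.tru
  | .spred p args, η, ρ => ⨆ d, (⨅ i, (args i).klEq M η ρ (d i)) ⊓ M (.spred p d)
  | .dpred p args t, η, ρ =>
      ⨆ d, (⨅ i, (args i).klEq M η ρ (d i)) ⊓ M (.dpred p d (t.val η))
  | .eqO _ a b, η, ρ => ⨆ d, a.klEq M η ρ d ⊓ b.klEq M η ρ d
  | .eqT a b, η, _ => TV.ofProp (a.val η = b.val η)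
  | .neg φ, η, ρ => (φ.kl M η ρ).neg
  | .and φ ψ, η, ρ => φ.kl M η ρ ⊓ ψ.kl M η ρ
  | .or φ ψ, η, ρ => φ.kl M η ρ ⊔ ψ.kl M η ρ
  | .allO τ x φ, η, ρ => ⨅ d : D τ, φ.kl M η (updateObj ρ τ x d)
  | .exO τ x φ, η, ρ => ⨆ d : D τ, φ.kl M η (updateObj ρ τ x d)
  | .allT x φ, η, ρ => ⨅ n : ℕ, φ.kl M (Function.update η x n) ρ
  | .exT x φ, η, ρ => ⨆ n : ℕ, φ.kl M (Function.update η x n) ρ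

/-! ## Definitions under the well-founded semantics -/

/-- The truth value of: the head, under the given assignment, is the domain atom `A`. -/
noncomputable def Head.kl {D : V.Ty → Type v} (M : PInterp V D) (η : ℕ → ℕ)
    (ρ : ∀ τ, ℕ → D τ) (A : Atom V D) : Head V → TV
  | .spred p args => ⨆ d, (⨅ i, (args i).klEq M η ρ (d i)) ⊓ TV.ofProp (A = .spred p d)
  | .dpred p args t =>
      ⨆ d, (⨅ i, (args i).klEq M η ρ (d i)) ⊓ TV.ofProp (A = .dpred p d (t.val η))
  | .sfun f args v =>
      ⨆ d, ⨆ e, (⨅ i, (args i).klEq M η ρ (d i)) ⊓ v.klEq M η ρ e ⊓ TV.ofProp (A = .sfun f d e)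
  | .dfun f args t v =>
      ⨆ d, ⨆ e, (⨅ i, (args i).klEq M η ρ (d i)) ⊓ v.klEq M η ρ e ⊓
        TV.ofProp (A = .dfun f d (t.val η) e)

/-- The truth value of the disjunction of the bodies of all rule instances with head `A`. -/
noncomputable def bodyVal {D : V.Ty → Type v} (Δ : Set (Rule V)) (M : PInterp V D)
    (A : Atom V D) : TV :=
  ⨆ r ∈ Δ, ⨆ η : ℕ → ℕ, ⨆ ρ : ∀ τ, ℕ → D τ, r.head.kl M η ρ A ⊓ r.body.kl M η ρ

/-- `A` is an atom of a symbol that occurs in the head of some rule. The other atoms are open. -/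
def IsDefined {D : V.Ty → Type v} (Δ : Set (Rule V)) (A : Atom V D) : Prop :=
  ∃ r ∈ Δ, r.head.sym = A.sym

open Classical in
/-- `M` with all atoms of `U` made false. -/
noncomputable def falsify {D : V.Ty → Type v} (M : PInterp V D) (U : Set (Atom V D)) :
    PInterp V D :=
  fun A => if A ∈ U then TV.fls else M A

/-- `U` is an unfounded set of defined atoms: all their bodies are false once they are all made
false. -/
def IsUnfounded {D : V.Ty → Type v} (Δ : Set (Rule V)) (M : PInterp V D) (U : Set (Atom V D)) :
    Prop :=
  ∀ A ∈ U, IsDefined Δ A ∧ bodyVal Δ (falsify M U) A = TV.fls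

/-- `M` agrees with `O` on the open atoms and is closed under the two inference steps of the
well-founded semantics: atoms with a true body are true, and atoms in unfounded sets are false. -/
def IsWFClosed {D : V.Ty → Type v} (Δ : Set (Rule V)) (O M : PInterp V D) : Prop :=
  (∀ A, ¬ IsDefined Δ A → M A = O A) ∧
  (∀ A, IsDefined Δ A → bodyVal Δ M A = TV.tru → M A = TV.tru) ∧
  (∀ U, IsUnfounded Δ M U → ∀ A ∈ U, M A = TV.fls)

/-- `M` is the well-founded model of `Δ` that extends the interpretation of the open symbols in
`O`: the least fixpoint, in the precision order, of the two inference steps. -/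
def IsWFModel {D : V.Ty → Type v} (Δ : Set (Rule V)) (O M : PInterp V D) : Prop :=
  IsWFClosed Δ O M ∧ ∀ N, IsWFClosed Δ O N → ∀ A, (M A).Prec (N A)

/-- `M` satisfies the definition `Δ`: it is the well-founded model of `Δ` extending its own
interpretation of the open symbols. -/
def Interp.SatDef {D : V.Ty → Type v} (M : Interp V D) (Δ : Set (Rule V)) : Prop :=
  IsWFModel Δ M.toPartial M.toPartial

/-- The structure `M` is a model of the theory `T`. -/
def LTStructure.Models (M : LTStructure.{u, v} V) (T : Theory V) : Prop :=
  (∀ φ ∈ T.sentences, ∀ η ρ, φ.Sat M.interp η ρ) ∧ M.interp.SatDef T.rules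

/-- All defined atoms are two-valued in `M` and have the value given by the definition. -/
def DefTrue {D : V.Ty → Type v} (Δ : Set (Rule V)) (M : PInterp V D) : Prop :=
  (∀ A, IsDefined Δ A → M A ≠ TV.unk) ∧ IsWFModel Δ M M

/-- Some defined atom is interpreted incorrectly in `M`: it is true or false in `M`, and under no
two-valued interpretation `G` of the open symbols that refines `M` is this the value that the
definition gives to it. -/
def DefFalse {D : V.Ty → Type v} (Δ : Set (Rule V)) (M : PInterp V D) : Prop :=
  ∃ A, IsDefined Δ A ∧ M A ≠ TV.unk ∧
    ∀ G : Interp V D, (∀ B, ¬ IsDefined Δ B → (M B).Prec (G.toPartial B)) →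
      ∀ W, IsWFModel Δ G.toPartial W → W A ≠ M A

open Classical in
/-- The Kleene valuation of a definition. -/
noncomputable def klDef {D : V.Ty → Type v} (M : PInterp V D) (Δ : Set (Rule V)) : TV :=
  if DefTrue Δ M then TV.tru else if DefFalse Δ M then TV.fls else TV.unk

/-- The Kleene valuation of a sentence; its value does not depend on the assignment. -/
noncomputable def klSentence {D : V.Ty → Type v} (M : PInterp V D) (φ : Formula V) : TV :=
  ⨅ η : ℕ → ℕ, ⨅ ρ : ∀ τ, ℕ → D τ, φ.kl M η ρ

open Classical in
/-- The Kleene valuation of a theory. -/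
noncomputable def klTheory {D : V.Ty → Type v} (M : PInterp V D) (T : Theory V) : TV :=
  if (∀ φ ∈ T.sentences, klSentence M φ = TV.tru) ∧ klDef M T.rules = TV.tru then TV.tru
  else if (∃ φ ∈ T.sentences, klSentence M φ = TV.fls) ∨ klDef M T.rules = TV.fls then TV.fls
  else TV.unk

/-! ## Progression and the Markov properties -/

/-- The `k`-chain `I` is `T`-compatible: `T` has a model that extends `I`. -/
def Compatible (T : Theory V) {k : ℕ} (I : Chain.{u, v} V k) : Prop :=
  ∃ M : LTStructure.{u, v} V, M.Extends I ∧ M.Models T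

/-- The state `S` is a `T`-successor of the `k`-chain `I`. -/
def IsSuccessor (T : Theory V) {k : ℕ} (I : Chain.{u, v} V k) (S : State.{u, v} V) : Prop :=
  ∃ J : Chain.{u, v} V (k + 1), IsDirectExtension J I S ∧ Compatible T J

/-- The Markov property. -/
def MarkovProperty (T : Theory V) : Prop :=
  ∀ (k k' : ℕ) (I : Chain.{u, v} V k) (I' : Chain.{u, v} V k'),
    Compatible T I → Compatible T I' → I.state (Fin.last k) = I'.state (Fin.last k') →
      ∀ S : State.{u, v} V, IsSuccessor T I S ↔ IsSuccessor T I' S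

/-- The `k`-chain `I` is weakly `T`-compatible. -/
def WeaklyCompatible (T : Theory V) {k : ℕ} (I : Chain.{u, v} V k) : Prop :=
  klTheory I.toPartial T ≠ TV.fls

/-- The state `S` is a weak `T`-successor of the `k`-chain `I`. -/
def IsWeakSuccessor (T : Theory V) {k : ℕ} (I : Chain.{u, v} V k) (S : State.{u, v} V) : Prop :=
  ∃ J : Chain.{u, v} V (k + 1), IsDirectExtension J I S ∧ WeaklyCompatible T J

/-- The weak Markov property. -/
def WeakMarkovProperty (T : Theory V) : Prop :=
  ∀ (k k' : ℕ) (I : Chain.{u, v} V k) (I' : Chain.{u, v} V k'),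
    WeaklyCompatible T I → WeaklyCompatible T I' →
      I.state (Fin.last k) = I'.state (Fin.last k') →
      ∀ S : State.{u, v} V, IsWeakSuccessor T I S ↔ IsWeakSuccessor T I' S

end Semantics

end LTC

namespace LTC

/-! ### Truth values: suprema, infima and precision -/

namespace TV

theorem bot_eq : (⊥ : TV) = fls :=
  le_antisymm bot_le (show rank fls ≤ rank ⊥ from Fin.zero_le _)

theorem top_eq : (⊤ : TV) = tru :=
  le_antisymm (show rank ⊤ ≤ rank tru from Fin.le_last _) le_top

theorem lt_tru {a : TV} (h : a ≠ tru) : a < tru := top_eq ▸ lt_top_iff_ne_top.2 (top_eq ▸ h)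

/-- Only `tru` lies strictly above `unk`, so the threshold `unk` in `iSup_eq_top` already yields an
index. Hence infinite disjunctions are true only through a witness; dually `iInf_eq_fls`. -/
theorem iSup_eq_tru {ι : Sort*} {f : ι → TV} : ⨆ i, f i = tru ↔ ∃ i, f i = tru := by
  rw [← top_eq, iSup_eq_top]
  refine ⟨fun h => ?_, fun ⟨i, hi⟩ b hb => ⟨i, hi ▸ hb⟩⟩
  obtain ⟨i, hi⟩ := h unk (top_eq ▸ lt_tru (by simp))
  refine ⟨i, ?_⟩
  have hi' : rank unk < rank (f i) := hi
  rw [top_eq]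
  cases hf : f i <;> simp_all [rank]

theorem iSup_eq_fls {ι : Sort*} {f : ι → TV} : ⨆ i, f i = fls ↔ ∀ i, f i = fls := by
  rw [← bot_eq, iSup_eq_bot]

theorem iInf_eq_tru {ι : Sort*} {f : ι → TV} : ⨅ i, f i = tru ↔ ∀ i, f i = tru := by
  rw [← top_eq, iInf_eq_top]

theorem iInf_eq_fls {ι : Sort*} {f : ι → TV} : ⨅ i, f i = fls ↔ ∃ i, f i = fls := by
  rw [← bot_eq, iInf_eq_bot]
  have hu : ⊥ < unk := by rw [bot_eq]; exact (show rank fls < rank unk by simp [rank])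
  refine ⟨fun h => ?_, fun ⟨i, hi⟩ b hb => ⟨i, hi ▸ hb⟩⟩
  obtain ⟨i, hi⟩ := h unk hu
  refine ⟨i, ?_⟩
  have hi' : rank (f i) < rank unk := hi
  rw [bot_eq]
  cases hf : f i <;> simp_all [rank]

theorem inf_eq_tru {a b : TV} : a ⊓ b = tru ↔ a = tru ∧ b = tru := by
  rw [← top_eq, inf_eq_top_iff]

theorem inf_eq_fls {a b : TV} : a ⊓ b = fls ↔ a = fls ∨ b = fls := by
  rw [← bot_eq]; exact min_eq_bot

theorem sup_eq_tru {a b : TV} : a ⊔ b = tru ↔ a = tru ∨ b = tru := by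
  rw [← top_eq]; exact max_eq_top

theorem sup_eq_fls {a b : TV} : a ⊔ b = fls ↔ a = fls ∧ b = fls := by
  rw [← bot_eq, sup_eq_bot_iff]

theorem neg_eq_tru {a : TV} : a.neg = tru ↔ a = fls := by cases a <;> simp [neg]

theorem neg_eq_fls {a : TV} : a.neg = fls ↔ a = tru := by cases a <;> simp [neg]

theorem ofProp_eq_tru {p : Prop} : ofProp p = tru ↔ p := by simp [ofProp]

theorem ofProp_eq_fls {p : Prop} : ofProp p = fls ↔ ¬ p := by simp [ofProp]

theorem ofProp_ne_unk (p : Prop) : ofProp p ≠ unk := by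
  by_cases h : p <;> simp [ofProp, h]

theorem eq_ofProp {a : TV} {p : Prop} (ht : a = tru ↔ p) (hf : a = fls ↔ ¬ p) :
    a = ofProp p := by
  by_cases h : p
  · rw [ht.2 h, ofProp_eq_tru.2 h]
  · rw [hf.2 h, ofProp_eq_fls.2 h]

/-- Splits precision into preservation of `tru` and of `fls`, the form in which each Kleene
connective can be checked. -/
theorem prec_iff {a b : TV} : a.Prec b ↔ (a = tru → b = tru) ∧ (a = fls → b = fls) := by
  cases a <;> cases b <;> simp [Prec]

namespace Prec

theorem refl (a : TV) : a.Prec a := Or.inr rfl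

theorem of_eq {a b : TV} (h : a = b) : a.Prec b := Or.inr h

theorem antisymm {a b : TV} (h : a.Prec b) (h' : b.Prec a) : a = b := by
  rcases h with rfl | rfl
  · rcases h' with rfl | rfl <;> rfl
  · rfl

theorem eq_of_ne_unk {a b : TV} (h : a.Prec b) (ha : a ≠ unk) : b = a :=
  (h.resolve_left ha).symm

theorem tru {b : TV} (h : TV.tru.Prec b) : b = TV.tru := h.eq_of_ne_unk (by simp)

theorem fls {b : TV} (h : TV.fls.Prec b) : b = TV.fls := h.eq_of_ne_unk (by simp)

theorem iSup {ι : Sort*} {f g : ι → TV} (h : ∀ i, (f i).Prec (g i)) :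
    (⨆ i, f i).Prec (⨆ i, g i) := by
  simp only [prec_iff, iSup_eq_tru, iSup_eq_fls] at *
  exact ⟨fun ⟨i, hi⟩ => ⟨i, (h i).1 hi⟩, fun hf i => (h i).2 (hf i)⟩

theorem iInf {ι : Sort*} {f g : ι → TV} (h : ∀ i, (f i).Prec (g i)) :
    (⨅ i, f i).Prec (⨅ i, g i) := by
  simp only [prec_iff, iInf_eq_tru, iInf_eq_fls] at *
  exact ⟨fun hf i => (h i).1 (hf i), fun ⟨i, hi⟩ => ⟨i, (h i).2 hi⟩⟩

theorem inf {a b c d : TV} (h : a.Prec b) (h' : c.Prec d) : (a ⊓ c).Prec (b ⊓ d) := by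
  simp only [prec_iff, inf_eq_tru, inf_eq_fls] at *
  tauto

theorem sup {a b c d : TV} (h : a.Prec b) (h' : c.Prec d) : (a ⊔ c).Prec (b ⊔ d) := by
  simp only [prec_iff, sup_eq_tru, sup_eq_fls] at *
  tauto

theorem neg {a b : TV} (h : a.Prec b) : a.neg.Prec b.neg := by
  simp only [prec_iff, neg_eq_tru, neg_eq_fls] at *
  tauto

end Prec

end TV

variable {V : Vocabulary.{u}} {D : V.Ty → Type v}

/-! ### Precision and the Kleene valuation -/

/-- On static atoms, `X` is less precise than `Y`. -/
def PrecStatic (X Y : PInterp V D) : Prop :=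
  (∀ p d, (X (.spred p d)).Prec (Y (.spred p d))) ∧
    ∀ f d e, (X (.sfun f d e)).Prec (Y (.sfun f d e))

/-- The time point `n` of `X` is less precise than the time point `m` of `Y`. -/
def PrecAt (X : PInterp V D) (n : ℕ) (Y : PInterp V D) (m : ℕ) : Prop :=
  (∀ p d, (X (.dpred p d n)).Prec (Y (.dpred p d m))) ∧
    ∀ f d e, (X (.dfun f d n e)).Prec (Y (.dfun f d m e))

theorem ObjTerm.klEq_prec {X Y : PInterp V D} {η η' : ℕ → ℕ} (ρ : ∀ τ, ℕ → D τ)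
    (hs : PrecStatic X Y) {τ : V.Ty} (a : ObjTerm V τ)
    (hd : ∀ t ∈ a.dynTimes, PrecAt X (t.val η) Y (t.val η')) (d : D τ) :
    (a.klEq X η ρ d).Prec (a.klEq Y η' ρ d) := by
  induction a with
  | var τ x => exact TV.Prec.refl _
  | sfun f args ih =>
    exact .iSup fun b => .inf (.iInf fun i =>
      ih i (fun t ht => hd t (Set.mem_iUnion_of_mem i ht)) _) (hs.2 _ _ _)
  | dfun f args t ih =>
    exact .iSup fun b => .inf (.iInf fun i =>
      ih i (fun t ht => hd t (.inl (Set.mem_iUnion_of_mem i ht))) _) ((hd t (.inr rfl)).2 _ _ _)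

theorem TimeTerm.self_mem_subterms (t : TimeTerm) : t ∈ t.subterms := by
  cases t <;> simp [TimeTerm.subterms]

/-- Two assignments of the time variables are allowed so that one induction serves both purposes: `η
= η'` gives monotonicity, and differing `η`, `η'` give translation along time. Time quantifiers must
be absent, since they would reach all time points; `he` keeps equations between time terms
unchanged. -/
theorem Formula.kl_prec {X Y : PInterp V D} {η η' : ℕ → ℕ} (hs : PrecStatic X Y)
    (φ : Formula V) (hq : ∀ y, ¬ φ.QuantifiesTime y)
    (hd : ∀ t ∈ φ.dynTimes, PrecAt X (t.val η) Y (t.val η'))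
    (he : ∀ s ∈ φ.timeTerms, ∀ t ∈ φ.timeTerms, s.val η = t.val η ↔ s.val η' = t.val η')
    (ρ : ∀ τ, ℕ → D τ) :
    (φ.kl X η ρ).Prec (φ.kl Y η' ρ) := by
  induction φ generalizing ρ with
  | top => exact TV.Prec.refl _
  | spred p args =>
    exact .iSup fun b => .inf (.iInf fun i => (args i).klEq_prec ρ hs
      (fun t ht => hd t (Set.mem_iUnion_of_mem i ht)) _) (hs.1 _ _)
  | dpred p args t =>
    exact .iSup fun b => .inf (.iInf fun i => (args i).klEq_prec ρ hs
      (fun t ht => hd t (.inl (Set.mem_iUnion_of_mem i ht))) _) ((hd t (.inr rfl)).1 _ _)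
  | eqO τ a b =>
    exact .iSup fun c => .inf (a.klEq_prec ρ hs (fun t ht => hd t (.inl ht)) _)
      (b.klEq_prec ρ hs (fun t ht => hd t (.inr ht)) _)
  | eqT a b =>
    refine .of_eq (congrArg TV.ofProp (propext ?_))
    exact he a (.inl a.self_mem_subterms) b (.inr b.self_mem_subterms)
  | neg φ ih => exact (ih hq hd he ρ).neg
  | and φ ψ ih ih' =>
    exact .inf (ih (fun y h => hq y (.inl h)) (fun t ht => hd t (.inl ht))
        (fun s h t h' => he s (.inl h) t (.inl h')) ρ)
      (ih' (fun y h => hq y (.inr h)) (fun t ht => hd t (.inr ht))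
        (fun s h t h' => he s (.inr h) t (.inr h')) ρ)
  | or φ ψ ih ih' =>
    exact .sup (ih (fun y h => hq y (.inl h)) (fun t ht => hd t (.inl ht))
        (fun s h t h' => he s (.inl h) t (.inl h')) ρ)
      (ih' (fun y h => hq y (.inr h)) (fun t ht => hd t (.inr ht))
        (fun s h t h' => he s (.inr h) t (.inr h')) ρ)
  | allO τ x φ ih => exact .iInf fun d => ih hq hd he _
  | exO τ x φ ih => exact .iSup fun d => ih hq hd he _
  | allT x φ ih => exact absurd (.inl rfl) (hq x)
  | exT x φ ih => exact absurd (.inl rfl) (hq x)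

theorem ObjTerm.dynTimes_subset {τ : V.Ty} (a : ObjTerm V τ) : a.dynTimes ⊆ a.timeTerms := by
  induction a with
  | var τ x => exact subset_rfl
  | sfun f args ih => exact Set.iUnion_mono ih
  | dfun f args t ih =>
    exact Set.union_subset_union (Set.iUnion_mono ih)
      (Set.singleton_subset_iff.2 t.self_mem_subterms)

theorem Formula.dynTimes_subset (φ : Formula V) : φ.dynTimes ⊆ φ.timeTerms := by
  induction φ with
  | top => exact subset_rfl
  | spred p args => exact Set.iUnion_mono fun i => (args i).dynTimes_subset
  | dpred p args t =>
    exact Set.union_subset_union (Set.iUnion_mono fun i => (args i).dynTimes_subset)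
      (Set.singleton_subset_iff.2 t.self_mem_subterms)
  | eqO τ a b => exact Set.union_subset_union a.dynTimes_subset b.dynTimes_subset
  | eqT a b => exact Set.empty_subset _
  | neg φ ih => exact ih
  | and φ ψ ih ih' => exact Set.union_subset_union ih ih'
  | or φ ψ ih ih' => exact Set.union_subset_union ih ih'
  | allO τ x φ ih => exact ih
  | exO τ x φ ih => exact ih
  | allT x φ ih => exact ih.trans Set.subset_union_right
  | exT x φ ih => exact ih.trans Set.subset_union_right

theorem Formula.QuantifiesTime.mem_timeTerms {φ : Formula V} {y : ℕ} (h : φ.QuantifiesTime y) :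
    .var y ∈ φ.timeTerms := by
  induction φ with
  | top | spred | dpred | eqO | eqT => exact h.elim
  | neg φ ih => exact ih h
  | and φ ψ ih ih' => exact h.imp ih ih'
  | or φ ψ ih ih' => exact h.imp ih ih'
  | allO τ x φ ih => exact ih h
  | exO τ x φ ih => exact ih h
  | allT x φ ih => exact h.imp (fun (h : x = y) => h ▸ rfl) ih
  | exT x φ ih => exact h.imp (fun (h : x = y) => h ▸ rfl) ih

theorem Head.dynTimes_subset (h : Head V) : h.dynTimes ⊆ h.timeTerms := by
  cases h with
  | spred p args => exact Set.iUnion_mono fun i => (args i).dynTimes_subset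
  | dpred p args t =>
    exact (Set.iUnion_mono fun i => (args i).dynTimes_subset).trans Set.subset_union_left
  | sfun f args w =>
    exact Set.union_subset_union (Set.iUnion_mono fun i => (args i).dynTimes_subset)
      w.dynTimes_subset
  | dfun f args t w =>
    exact Set.union_subset_union ((Set.iUnion_mono fun i => (args i).dynTimes_subset).trans
      Set.subset_union_left) w.dynTimes_subset

/-- A quantified variable counts among the time terms, so it could only be the single variable that
the LTC form permits, and that one is not quantified in the body. -/
theorem Rule.IsLTC.not_quantifiesTime {r : Rule V} (hr : r.IsLTC) (y : ℕ) :
    ¬ r.body.QuantifiesTime y := by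
  intro h
  have hy : TimeTerm.var y ∈ r.timeTerms := .inr h.mem_timeTerms
  rcases hr with e | e | ⟨x, e, hx⟩ | ⟨x, ⟨-, e⟩, hx⟩
  · simp [e] at hy
  · simp [e] at hy
  · rw [e] at hy
    simp at hy
    exact hx (hy ▸ h)
  · have := e hy
    simp at this
    exact hx (this ▸ h)

/-- The target atom may move together with the assignment; `h₁`–`h₄` say that a head instance hits
`A` under `η` exactly when it hits `A'` under `η'`. -/
theorem Head.kl_prec {X Y : PInterp V D} {η η' : ℕ → ℕ} (hs : PrecStatic X Y) (h : Head V)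
    (hd : ∀ t ∈ h.dynTimes, PrecAt X (t.val η) Y (t.val η')) (ρ : ∀ τ, ℕ → D τ)
    {A A' : Atom V D} (h₁ : ∀ p d, A = .spred p d ↔ A' = .spred p d)
    (h₂ : ∀ f d e, A = .sfun f d e ↔ A' = .sfun f d e)
    (h₃ : ∀ p d, A = .dpred p d (h.time η) ↔ A' = .dpred p d (h.time η'))
    (h₄ : ∀ f d e, A = .dfun f d (h.time η) e ↔ A' = .dfun f d (h.time η') e) :
    (h.kl X η ρ A).Prec (h.kl Y η' ρ A') := by
  cases h with
  | spred p args =>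
    exact .iSup fun b => .inf (.iInf fun i => (args i).klEq_prec ρ hs
      (fun t ht => hd t (Set.mem_iUnion_of_mem i ht)) _)
      (.of_eq (congrArg TV.ofProp (propext (h₁ _ _))))
  | dpred p args t =>
    exact .iSup fun b => .inf (.iInf fun i => (args i).klEq_prec ρ hs
      (fun t ht => hd t (Set.mem_iUnion_of_mem i ht)) _)
      (.of_eq (congrArg TV.ofProp (propext (h₃ _ _))))
  | sfun f args w =>
    exact .iSup fun b => .iSup fun e => .inf (.inf (.iInf fun i => (args i).klEq_prec ρ hs
      (fun t ht => hd t (.inl (Set.mem_iUnion_of_mem i ht))) _)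
      (w.klEq_prec ρ hs (fun t ht => hd t (.inr ht)) _))
      (.of_eq (congrArg TV.ofProp (propext (h₂ _ _ _))))
  | dfun f args t w =>
    exact .iSup fun b => .iSup fun e => .inf (.inf (.iInf fun i => (args i).klEq_prec ρ hs
      (fun t ht => hd t (.inl (Set.mem_iUnion_of_mem i ht))) _)
      (w.klEq_prec ρ hs (fun t ht => hd t (.inr ht)) _))
      (.of_eq (congrArg TV.ofProp (propext (h₄ _ _ _))))

/-! ### Time points of atoms -/

/-- The time point of a domain atom; static atoms belong to time `0`. -/
def Atom.time : Atom V D → ℕ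
  | .spred _ _ => 0
  | .dpred _ _ n => n
  | .sfun _ _ _ => 0
  | .dfun _ _ n _ => n

/-- Moves a dynamic atom to the time point `m`; static atoms do not change. -/
def Atom.retime (m : ℕ) : Atom V D → Atom V D
  | .spred p d => .spred p d
  | .dpred p d _ => .dpred p d m
  | .sfun f d e => .sfun f d e
  | .dfun f d _ e => .dfun f d m e

theorem Atom.retime_retime (A : Atom V D) (n m : ℕ) : (A.retime n).retime m = A.retime m := by
  cases A <;> rfl

theorem Atom.retime_time (A : Atom V D) : A.retime A.time = A := by
  cases A <;> rfl

theorem Atom.sym_retime (A : Atom V D) (n : ℕ) : (A.retime n).sym = A.sym := by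
  cases A <;> rfl

theorem Atom.time_retime (A : Atom V D) : (∀ n, (A.retime n).time = n) ∨
    (∀ n, A.retime n = A) ∧ A.time = 0 := by
  cases A <;> simp [Atom.retime, Atom.time]

theorem Atom.time_retime_of_pos {A : Atom V D} (h : A.time ≠ 0) (n : ℕ) :
    (A.retime n).time = n := by
  rcases A.time_retime with h' | h'
  · exact h' n
  · exact absurd h'.2 h

theorem Head.kl_eq_fls {η : ℕ → ℕ} {h : Head V} {A : Atom V D} (hA : h.time η ≠ A.time)
    (M : PInterp V D) (ρ : ∀ τ, ℕ → D τ) : h.kl M η ρ A = .fls := by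
  cases h with
  | spred p args =>
    refine TV.iSup_eq_fls.2 fun d => TV.inf_eq_fls.2 (.inr (TV.ofProp_eq_fls.2 ?_))
    rintro rfl; exact hA rfl
  | dpred p args t =>
    refine TV.iSup_eq_fls.2 fun d => TV.inf_eq_fls.2 (.inr (TV.ofProp_eq_fls.2 ?_))
    rintro rfl; exact hA rfl
  | sfun p args w =>
    refine TV.iSup_eq_fls.2 fun d => TV.iSup_eq_fls.2 fun e =>
      TV.inf_eq_fls.2 (.inr (TV.ofProp_eq_fls.2 ?_))
    rintro rfl; exact hA rfl
  | dfun p args t w =>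
    refine TV.iSup_eq_fls.2 fun d => TV.iSup_eq_fls.2 fun e =>
      TV.inf_eq_fls.2 (.inr (TV.ofProp_eq_fls.2 ?_))
    rintro rfl; exact hA rfl

/-- Each atom depends monotonically, in the precision order, on the atoms at times that are not
later. -/
def TimeMonotone (B : PInterp V D → Atom V D → TV) : Prop :=
  ∀ A X Y, (∀ C : Atom V D, C.time ≤ A.time → (X C).Prec (Y C)) → (B X A).Prec (B Y A)

/-- Instances whose head lies at another time contribute `fls` on both sides; for the others,
stratification bounds every time point that is read. -/
theorem timeMonotone_bodyVal {Δ : Set (Rule V)} (hΔ : ∀ r ∈ Δ, r.IsLTC)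
    (hst : StratifiedOverTime Δ) : TimeMonotone (bodyVal (D := D) Δ) := by
  intro A X Y h
  refine .iSup fun r => .iSup fun hr => .iSup fun η => .iSup fun ρ => ?_
  by_cases hA : r.head.time η = A.time
  · have hs : PrecStatic X Y := ⟨fun _ _ => h _ (Nat.zero_le _), fun _ _ _ => h _ (Nat.zero_le _)⟩
    have hd : ∀ t ∈ r.head.dynTimes ∪ r.body.dynTimes, PrecAt X (t.val η) Y (t.val η) :=
      fun t ht => ⟨fun _ _ => h _ ((hst r hr t ht η).trans hA.le),
        fun _ _ _ => h _ ((hst r hr t ht η).trans hA.le)⟩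
    exact .inf (r.head.kl_prec hs (fun t ht => hd t (.inl ht)) ρ (fun _ _ => .rfl)
      (fun _ _ _ => .rfl) (fun _ _ => .rfl) (fun _ _ _ => .rfl))
      (r.body.kl_prec hs (hΔ r hr).not_quantifiesTime (fun t ht => hd t (.inr ht))
        (fun _ _ _ _ => .rfl) ρ)
  · rw [Head.kl_eq_fls hA, Head.kl_eq_fls hA, TV.inf_eq_fls.2 (.inl rfl),
      TV.inf_eq_fls.2 (.inl rfl)]
    exact .refl _

/-! ### Translation of rule bodies along time -/

/-- The static symbols and the time points `n` and `n + 1` are interpreted in `X` like the static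
symbols and the time points `m` and `m + 1` in `Y`. -/
def Window (X : PInterp V D) (n : ℕ) (Y : PInterp V D) (m : ℕ) : Prop :=
  (∀ A : Atom V D, X (A.retime n) = Y (A.retime m)) ∧
    ∀ A : Atom V D, X (A.retime (n + 1)) = Y (A.retime (m + 1))

theorem Window.symm {X Y : PInterp V D} {n m : ℕ} (h : Window X n Y m) : Window Y m X n :=
  ⟨fun A => (h.1 A).symm, fun A => (h.2 A).symm⟩

theorem precStatic_of_retime {X Y : PInterp V D} {n m : ℕ}
    (h : ∀ A : Atom V D, X (A.retime n) = Y (A.retime m)) : PrecStatic X Y :=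
  ⟨fun p d => .of_eq (h (.spred p d)), fun f d e => .of_eq (h (.sfun f d e))⟩

theorem precAt_of_retime {X Y : PInterp V D} {n m : ℕ}
    (h : ∀ A : Atom V D, X (A.retime n) = Y (A.retime m)) : PrecAt X n Y m :=
  ⟨fun p d => .of_eq (h (.dpred p d n)), fun f d e => .of_eq (h (.dfun f d n e))⟩

/-- The value of an atom after time `0` depends in the same way on the static symbols and on two
successive time points, wherever these time points are. -/
def ShiftInvariant (B : PInterp V D → Atom V D → TV) : Prop :=
  ∀ X n Y m, Window X n Y m → ∀ A : Atom V D, A.time = n + 1 → B X A = B Y (A.retime (m + 1))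

theorem Head.time_eq (h : Head V) :
    (∀ η, h.time η = 0) ∨ ∃ t ∈ h.timeTerms, ∀ η, h.time η = t.val η := by
  cases h with
  | spred | sfun => exact .inl fun _ => rfl
  | dpred p args t => exact .inr ⟨t, .inr t.self_mem_subterms, fun _ => rfl⟩
  | dfun p args t w => exact .inr ⟨t, .inl (.inr t.self_mem_subterms), fun _ => rfl⟩

/-- Bistate rules that define an atom at time `n + 1` can be moved to any time `m + 1`. -/
theorem Rule.IsLTC.exists_shift {r : Rule V} (hr : r.IsLTC)
    (hst : ∀ t ∈ r.head.dynTimes ∪ r.body.dynTimes, ∀ η : ℕ → ℕ, t.val η ≤ r.head.time η)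
    {η : ℕ → ℕ} {n : ℕ} (hn : r.head.time η = n + 1) (m : ℕ) :
    ∃ η', r.head.time η' = m + 1 ∧
      (∀ t ∈ r.head.dynTimes ∪ r.body.dynTimes,
        t.val η = n ∧ t.val η' = m ∨ t.val η = n + 1 ∧ t.val η' = m + 1) ∧
      ∀ s ∈ r.body.timeTerms, ∀ t ∈ r.body.timeTerms, s.val η = t.val η ↔ s.val η' = t.val η' := by
  obtain ⟨t₀, ht₀, e₀⟩ := r.head.time_eq.resolve_left fun h => by simp [h] at hn
  have ht₀' : t₀ ∈ r.timeTerms := .inl ht₀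
  rw [e₀] at hn
  have hx : ∃ x, r.timeTerms ⊆ {.var x, .succ (.var x)} := by
    rcases hr with e | e | ⟨x, e, -⟩ | ⟨x, ⟨-, e⟩, -⟩
    · simp [e] at ht₀'
    · rw [e] at ht₀'
      rw [Set.mem_singleton_iff.1 ht₀'] at hn
      simp [TimeTerm.val] at hn
    · rw [SingleStateIn] at e
      exact ⟨x, by simp [e]⟩
    · exact ⟨x, e⟩
  obtain ⟨x, hx⟩ := hx
  have hdyn : ∀ t ∈ r.head.dynTimes ∪ r.body.dynTimes, t ∈ r.timeTerms := fun t ht =>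
    ht.imp (fun h => r.head.dynTimes_subset h) (fun h => r.body.dynTimes_subset h)
  have hbody : ∀ η' : ℕ → ℕ, ∀ s ∈ r.body.timeTerms, ∀ t ∈ r.body.timeTerms,
      s.val η = t.val η ↔ s.val η' = t.val η' := by
    intro η' s hs t ht
    rcases hx (.inr hs) with rfl | rfl <;> rcases hx (.inr ht) with rfl | rfl <;>
      simp [TimeTerm.val]
  -- If the head is at `x`, stratification forbids dynamic symbols at `𝓢(x)`, so everything is read
  -- at `n + 1` and `x` moves to `m + 1`. If it is at `𝓢(x)`, then `x` is `n` and moves to `m`.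
  -- Constant assignments suffice because no other time variable occurs.
  rcases hx ht₀' with rfl | rfl
  · refine ⟨fun _ => m + 1, by rw [e₀]; rfl, fun t ht => ?_, hbody _⟩
    rcases hx (hdyn t ht) with rfl | rfl
    · exact .inr ⟨hn, rfl⟩
    · have := hst _ ht (fun _ => 0)
      rw [e₀] at this
      simp [TimeTerm.val] at this
  · have hn' : η x = n := by simpa [TimeTerm.val] using hn
    refine ⟨fun _ => m, by rw [e₀]; rfl, fun t ht => ?_, hbody _⟩
    rcases hx (hdyn t ht) with rfl | rfl
    · exact .inl ⟨hn', rfl⟩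
    · exact .inr ⟨hn, rfl⟩

theorem bodyVal_le_of_window {Δ : Set (Rule V)} (hΔ : ∀ r ∈ Δ, r.IsLTC)
    (hst : StratifiedOverTime Δ) {X Y : PInterp V D} {n m : ℕ} (h : Window X n Y m)
    {A : Atom V D} (hA : A.time = n + 1) : bodyVal Δ X A ≤ bodyVal Δ Y (A.retime (m + 1)) := by
  refine iSup_le fun r => iSup_le fun hr => iSup_le fun η => iSup_le fun ρ => ?_
  by_cases hn : r.head.time η = A.time
  · rw [hA] at hn
    obtain ⟨η', hm, hd, he⟩ := (hΔ r hr).exists_shift (hst r hr) hn m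
    have key : ∀ t ∈ r.head.dynTimes ∪ r.body.dynTimes,
        PrecAt X (t.val η) Y (t.val η') ∧ PrecAt Y (t.val η') X (t.val η) := by
      intro t ht
      rcases hd t ht with ⟨e, e'⟩ | ⟨e, e'⟩ <;> rw [e, e']
      · exact ⟨precAt_of_retime h.1, precAt_of_retime h.symm.1⟩
      · exact ⟨precAt_of_retime h.2, precAt_of_retime h.symm.2⟩
    have hs := precStatic_of_retime h.1
    have hs' := precStatic_of_retime h.symm.1
    have h₁ : ∀ p d, A = .spred p d ↔ A.retime (m + 1) = .spred p d := by
      intro p d; cases A <;> simp [Atom.retime]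
    have h₂ : ∀ f d e, A = .sfun f d e ↔ A.retime (m + 1) = .sfun f d e := by
      intro f d e; cases A <;> simp [Atom.retime]
    have h₃ : ∀ p d, A = .dpred p d (r.head.time η) ↔
        A.retime (m + 1) = .dpred p d (r.head.time η') := by
      intro p d; rw [hn, hm]; cases A <;> simp_all [Atom.retime, Atom.time]
    have h₄ : ∀ f d e, A = .dfun f d (r.head.time η) e ↔
        A.retime (m + 1) = .dfun f d (r.head.time η') e := by
      intro f d e; rw [hn, hm]; cases A <;> simp_all [Atom.retime, Atom.time]
    have e₁ : r.head.kl X η ρ A = r.head.kl Y η' ρ (A.retime (m + 1)) :=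
      (r.head.kl_prec hs (fun t ht => (key t (.inl ht)).1) ρ h₁ h₂ h₃ h₄).antisymm
        (r.head.kl_prec hs' (fun t ht => (key t (.inl ht)).2) ρ (fun p d => (h₁ p d).symm)
          (fun f d e => (h₂ f d e).symm) (fun p d => (h₃ p d).symm) (fun f d e => (h₄ f d e).symm))
    have hq := (hΔ r hr).not_quantifiesTime
    have e₂ : r.body.kl X η ρ = r.body.kl Y η' ρ :=
      (r.body.kl_prec hs hq (fun t ht => (key t (.inr ht)).1) he ρ).antisymm
        (r.body.kl_prec hs' hq (fun t ht => (key t (.inr ht)).2)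
          (fun s hs t ht => (he s hs t ht).symm) ρ)
    rw [e₁, e₂]
    exact le_iSup_of_le r (le_iSup_of_le hr (le_iSup_of_le η' (le_iSup_of_le ρ le_rfl)))
  · rw [Head.kl_eq_fls hn, TV.inf_eq_fls.2 (.inl rfl), ← TV.bot_eq]
    exact bot_le

theorem shiftInvariant_bodyVal {Δ : Set (Rule V)} (hΔ : ∀ r ∈ Δ, r.IsLTC)
    (hst : StratifiedOverTime Δ) : ShiftInvariant (bodyVal (D := D) Δ) := by
  intro X n Y m h A hA
  refine (bodyVal_le_of_window hΔ hst h hA).antisymm ?_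
  have := bodyVal_le_of_window hΔ hst h.symm
    (A := A.retime (m + 1)) (Atom.time_retime_of_pos (by omega) _)
  rwa [Atom.retime_retime, ← hA, Atom.retime_time] at this

/-! ### Existence of well-founded models -/

section WellFounded

variable (B : PInterp V D → Atom V D → TV) (𝒟 : Set (Atom V D))

/-- `M` agrees with `O` off the set `𝒟` of defined atoms and is closed under the inference steps of
the well-founded semantics for the operator `B`. -/
def WFClosed (O M : PInterp V D) : Prop :=
  (∀ A ∉ 𝒟, M A = O A) ∧
  (∀ A ∈ 𝒟, B M A = .tru → M A = .tru) ∧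
  ∀ U : Set (Atom V D), (∀ A ∈ U, A ∈ 𝒟 ∧ B (falsify M U) A = .fls) → ∀ A ∈ U, M A = .fls

/-- The values that are derived by the inference steps of the well-founded semantics from partial
interpretations whose values are derived. -/
inductive Derivable (O : PInterp V D) : Atom V D → TV → Prop
  | opn (A : Atom V D) (hA : A ∉ 𝒟) (w : TV) (h : O A = w) : Derivable O A w
  | tru (M : PInterp V D) (hM : ∀ C, M C ≠ .unk → Derivable O C (M C)) (A : Atom V D)
      (hA : A ∈ 𝒟) (h : B M A = .tru) : Derivable O A .tru
  | fls (M : PInterp V D) (hM : ∀ C, M C ≠ .unk → Derivable O C (M C)) (U : Set (Atom V D))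
      (hU : ∀ A ∈ U, A ∈ 𝒟 ∧ B (falsify M U) A = .fls) (A : Atom V D) (hA : A ∈ U) :
      Derivable O A .fls

variable {B 𝒟}

theorem TimeMonotone.mono (hB : TimeMonotone B) {X Y : PInterp V D}
    (h : ∀ C, (X C).Prec (Y C)) (A : Atom V D) : (B X A).Prec (B Y A) :=
  hB A X Y fun C _ => h C

/-- Interpretations that agree where both are known have a common refinement, on which the operator
would have to be both true and false. -/
theorem TimeMonotone.not_compatible (hB : TimeMonotone B) {X Y : PInterp V D}
    (h : ∀ C, X C ≠ .unk → Y C ≠ .unk → X C = Y C) {A : Atom V D} (hX : B X A = .tru)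
    (hY : B Y A = .fls) : False := by
  classical
  let J : PInterp V D := fun C => if X C = .unk then Y C else X C
  have h₁ : ∀ C, (X C).Prec (J C) := fun C => by
    by_cases hC : X C = .unk
    · exact .inl hC
    · exact .inr (by simp [J, hC])
  have h₂ : ∀ C, (Y C).Prec (J C) := fun C => by
    by_cases hC : X C = .unk
    · exact .inr (by simp [J, hC])
    · by_cases hC' : Y C = .unk
      · exact .inl hC'
      · exact .inr (by simp [J, h C hC hC'])
  have e₁ := hB.mono h₁ A
  have e₂ := hB.mono h₂ A
  rw [hX] at e₁
  rw [hY] at e₂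
  exact absurd (e₁.tru.symm.trans e₂.fls) (by simp)

theorem falsify_of_mem {M : PInterp V D} {U : Set (Atom V D)} {A : Atom V D} (h : A ∈ U) :
    falsify M U A = .fls := if_pos h

theorem falsify_of_notMem {M : PInterp V D} {U : Set (Atom V D)} {A : Atom V D} (h : A ∉ U) :
    falsify M U A = M A := if_neg h

theorem falsify_prec {X Y : PInterp V D} {U U' : Set (Atom V D)} {C : Atom V D}
    (hU : C ∈ U ↔ C ∈ U') (h : (X C).Prec (Y C)) : (falsify X U C).Prec (falsify Y U' C) := by
  by_cases hC : C ∈ U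
  · rw [falsify_of_mem hC, falsify_of_mem (hU.1 hC)]
    exact .refl _
  · rwa [falsify_of_notMem hC, falsify_of_notMem fun h => hC (hU.2 h)]

/-- Consistency of the derivations. If `A` has a true body under `M` but lies in a set `U` unfounded
for `N`, then `M` and `falsify N U` never conflict: on `U` the value `fls` is derived, off `U` the
values of `N` are. This contradicts `TimeMonotone.not_compatible`. -/
theorem Derivable.unique (hB : TimeMonotone B) {O : PInterp V D} {A : Atom V D} {w w' : TV}
    (h : Derivable B 𝒟 O A w) (h' : Derivable B 𝒟 O A w') (hw' : w' ≠ .unk) : w = w' := by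
  induction h generalizing w' with
  | opn A hA w h =>
    cases h' with
    | opn _ _ _ h' => exact h.symm.trans h'
    | tru _ _ _ hA' => exact absurd hA' hA
    | fls _ _ U hU _ hAU => exact absurd (hU A hAU).1 hA
  | tru M hM A hA h ih =>
    cases h' with
    | opn _ hA' => exact absurd hA hA'
    | tru => rfl
    | fls N hN U hU _ hAU =>
      refine (hB.not_compatible (fun C hC hC' => ?_) h (hU A hAU).2).elim
      by_cases hCU : C ∈ U
      · rw [falsify_of_mem hCU]
        exact ih C hC (.fls N hN U hU C hCU) (by simp)
      · rw [falsify_of_notMem hCU] at hC' ⊢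
        exact ih C hC (hN C hC') hC'
  | fls M hM U hU A hAU ih =>
    -- The outer induction hypothesis covers only the values of `M`, not the atoms of `U`, so a
    -- second induction, on the competing derivation, excludes `tru` on all of `U` at once.
    have key : ∀ C w, Derivable B 𝒟 O C w → C ∈ U → w ≠ .unk → w = .fls := by
      intro C w hC
      induction hC with
      | opn C hC' => exact fun hCU => absurd (hU C hCU).1 hC'
      | fls => exact fun _ _ => rfl
      | tru N hN C hC h ih' =>
        intro hCU _
        refine (hB.not_compatible (fun E hE hE' => ?_) h (hU C hCU).2).elim
        by_cases hEU : E ∈ U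
        · rw [falsify_of_mem hEU]
          exact ih' E hE hEU hE
        · rw [falsify_of_notMem hEU] at hE' ⊢
          exact (ih E hE' (hN E hE) hE).symm
    exact (key A w' h' hAU hw').symm

variable (B 𝒟) in
open Classical in
/-- The well-founded model of the operator `B` on the defined atoms `𝒟`, where the open atoms are
interpreted as in `O`. -/
noncomputable def wfm (O : PInterp V D) : PInterp V D := fun A =>
  if Derivable B 𝒟 O A .tru then .tru else if Derivable B 𝒟 O A .fls then .fls else .unk

theorem derivable_wfm {O : PInterp V D} {A : Atom V D} (h : wfm B 𝒟 O A ≠ .unk) :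
    Derivable B 𝒟 O A (wfm B 𝒟 O A) := by
  rw [wfm] at h ⊢
  split_ifs at h ⊢ <;> first | assumption | exact absurd rfl h

theorem Derivable.prec_wfm (hB : TimeMonotone B) {O : PInterp V D} {A : Atom V D} {w : TV}
    (h : Derivable B 𝒟 O A w) : w.Prec (wfm B 𝒟 O A) := by
  cases w with
  | unk => exact .inl rfl
  | tru => exact .inr (by simp [wfm, h])
  | fls =>
    have : ¬ Derivable B 𝒟 O A .tru := fun h' => by
      simpa using h.unique hB h' (by simp)
    exact .inr (by simp [wfm, h, this])

theorem wfm_of_notMem (hB : TimeMonotone B) {O : PInterp V D} {A : Atom V D} (hA : A ∉ 𝒟) :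
    wfm B 𝒟 O A = O A := by
  by_cases h : wfm B 𝒟 O A = .unk
  · have := (Derivable.opn (B := B) A hA _ (rfl : O A = O A)).prec_wfm hB
    rw [h] at this ⊢
    exact (this.elim id id).symm
  · have hd := derivable_wfm h
    generalize wfm B 𝒟 O A = w at hd
    cases hd with
    | opn _ _ _ h => exact h.symm
    | tru _ _ _ hA' => exact absurd hA' hA
    | fls _ _ U hU _ hAU => exact absurd (hU A hAU).1 hA

theorem wfClosed_wfm (hB : TimeMonotone B) (O : PInterp V D) : WFClosed B 𝒟 O (wfm B 𝒟 O) :=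
  ⟨fun _ hA => wfm_of_notMem hB hA,
    fun A hA h => ((Derivable.tru _ (fun _ => derivable_wfm) A hA h).prec_wfm hB).tru,
    fun U hU A hA => ((Derivable.fls _ (fun _ => derivable_wfm) U hU A hA).prec_wfm hB).fls⟩

theorem prec_of_ne_unk_imp {a b : TV} (h : a ≠ .unk → a.Prec b) : a.Prec b := by
  by_cases ha : a = .unk
  · exact .inl ha
  · exact h ha

theorem Derivable.prec_of_wfClosed (hB : TimeMonotone B) {O N : PInterp V D}
    (hN : WFClosed B 𝒟 O N) {A : Atom V D} {w : TV} (h : Derivable B 𝒟 O A w) :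
    w.Prec (N A) := by
  induction h with
  | opn A hA w h => exact .inr (h.symm.trans (hN.1 A hA).symm)
  | tru M _ A hA h ih =>
    have := hB.mono (fun C => prec_of_ne_unk_imp (ih C)) A
    rw [h] at this
    exact .inr (hN.2.1 A hA this.tru).symm
  | fls M _ U hU A hA ih =>
    refine .inr (hN.2.2 U (fun C hC => ⟨(hU C hC).1, ?_⟩) A hA).symm
    have := hB.mono (fun C => falsify_prec (U := U) .rfl (prec_of_ne_unk_imp (ih C))) C
    rw [(hU C hC).2] at this
    exact this.fls

theorem wfm_prec (hB : TimeMonotone B) {O N : PInterp V D} (hN : WFClosed B 𝒟 O N)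
    (A : Atom V D) : (wfm B 𝒟 O A).Prec (N A) :=
  prec_of_ne_unk_imp fun h => (derivable_wfm h).prec_of_wfClosed hB hN

/-- Turns the relational semantics into an equation: the least closed interpretation exists and is
unique. -/
theorem isWFModel_iff {Δ : Set (Rule V)} (hB : TimeMonotone (bodyVal (D := D) Δ))
    (O M : PInterp V D) : IsWFModel Δ O M ↔ M = wfm (bodyVal Δ) {A | IsDefined Δ A} O := by
  constructor
  · exact fun h => funext fun A => (h.2 _ (wfClosed_wfm hB O) A).antisymm (wfm_prec hB h.1 A)
  · rintro rfl
    exact ⟨wfClosed_wfm hB O, fun N hN => wfm_prec hB hN⟩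

/-! ### Splitting over time -/

/-- A derivation of an atom up to time `n` can be replayed with the open atoms of `O'`: later
premises are ignored, and unfounded sets are cut down to times at most `n`. -/
theorem wfm_prec_of_le (hB : TimeMonotone B) {O O' : PInterp V D} {n : ℕ}
    (h : ∀ A ∉ 𝒟, A.time ≤ n → (O A).Prec (O' A)) {A : Atom V D} (hA : A.time ≤ n) :
    (wfm B 𝒟 O A).Prec (wfm B 𝒟 O' A) := by
  have hc := wfClosed_wfm (𝒟 := 𝒟) hB O'
  suffices ∀ A w, Derivable B 𝒟 O A w → A.time ≤ n → w.Prec (wfm B 𝒟 O' A) from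
    prec_of_ne_unk_imp fun hA' => this A _ (derivable_wfm hA') hA
  intro A w hw
  induction hw with
  | opn A hA w hw =>
    intro hn
    rw [wfm_of_notMem hB hA, ← hw]
    exact h A hA hn
  | tru M _ A hA h ih =>
    intro hn
    have := hB A M (wfm B 𝒟 O') fun C hC =>
      prec_of_ne_unk_imp fun hC' => ih C hC' (hC.trans hn)
    rw [h] at this
    exact .inr (hc.2.1 A hA this.tru).symm
  | fls M _ U hU A hA ih =>
    intro hn
    refine .inr (hc.2.2 {C ∈ U | C.time ≤ n} (fun C hC => ⟨(hU C hC.1).1, ?_⟩) A ⟨hA, hn⟩).symm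
    have := hB C (falsify M U) (falsify (wfm B 𝒟 O') {C ∈ U | C.time ≤ n}) fun E hE =>
      falsify_prec ⟨fun h => ⟨h, hE.trans hC.2⟩, fun h => h.1⟩
        (prec_of_ne_unk_imp fun hE' => ih E hE' (hE.trans hC.2))
    rw [(hU C hC.1).2] at this
    exact this.fls

theorem wfm_congr_of_le (hB : TimeMonotone B) {O O' : PInterp V D} {n : ℕ}
    (h : ∀ A ∉ 𝒟, A.time ≤ n → O A = O' A) {A : Atom V D} (hA : A.time ≤ n) :
    wfm B 𝒟 O A = wfm B 𝒟 O' A :=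
  (wfm_prec_of_le hB (fun A h₁ h₂ => .of_eq (h A h₁ h₂)) hA).antisymm
    (wfm_prec_of_le hB (fun A h₁ h₂ => .of_eq (h A h₁ h₂).symm) hA)

variable (B 𝒟) in
/-- The defined atoms at time `n` have the values in `X` that they are given when all other atoms
are taken to be open. -/
def CorrectAt (n : ℕ) (X : PInterp V D) : Prop :=
  ∀ A : Atom V D, A.time = n → wfm B {A ∈ 𝒟 | A.time = n} X A = X A

theorem correctAt_wfm (hB : TimeMonotone B) (O : PInterp V D) (n : ℕ) :
    CorrectAt B 𝒟 n (wfm B 𝒟 O) := by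
  intro A _
  set W := wfm B 𝒟 O with hW
  set X := wfm B {A ∈ 𝒟 | A.time = n} W with hX
  have hWc : WFClosed B 𝒟 O W := wfClosed_wfm hB O
  have hXc : WFClosed B {A ∈ 𝒟 | A.time = n} W X := wfClosed_wfm hB W
  -- `W` is closed for the local problem too, so minimality gives `X` below `W`. Conversely, global
  -- derivations are replayed in `X`; away from time `n` it equals `W` by definition.
  refine (wfm_prec hB ⟨fun _ _ => rfl, fun A hA => hWc.2.1 A hA.1,
    fun U hU => hWc.2.2 U fun C hC => ⟨(hU C hC).1.1, (hU C hC).2⟩⟩ A).antisymm ?_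
  suffices ∀ A w, Derivable B 𝒟 O A w → w.Prec (X A) from
    prec_of_ne_unk_imp fun h => this A _ (derivable_wfm h)
  intro A w hw
  induction hw with
  | opn A hA w hw =>
    rw [hXc.1 A fun h => hA h.1, hWc.1 A hA, hw]
    exact .refl _
  | tru M hM A hA h ih =>
    by_cases hn : A.time = n
    · have := hB.mono (fun C => prec_of_ne_unk_imp (ih C)) A
      rw [h] at this
      exact .inr (hXc.2.1 A ⟨hA, hn⟩ this.tru).symm
    · rw [hXc.1 A fun h => hn h.2]
      exact (Derivable.tru M hM A hA h).prec_wfm hB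
  | fls M hM U hU A hA ih =>
    -- Members of `U` at other times are open in the local problem, but already false in `W`. So
    -- cutting `U` to time `n` loses nothing.
    have hWU : ∀ C ∈ U, W C = .fls := fun C hC =>
      ((Derivable.fls M hM U hU C hC).prec_wfm hB).fls
    by_cases hn : A.time = n
    · refine .inr (hXc.2.2 {C ∈ U | C.time = n}
        (fun C hC => ⟨⟨(hU C hC.1).1, hC.2⟩, ?_⟩) A ⟨hA, hn⟩).symm
      have := hB C (falsify M U) (falsify X {C ∈ U | C.time = n}) fun E hE => by
        by_cases hEU : E ∈ U
        · refine .inr ?_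
          rw [falsify_of_mem hEU]
          by_cases hEn : E.time = n
          · exact (falsify_of_mem (show E ∈ {C ∈ U | C.time = n} from ⟨hEU, hEn⟩)).symm
          · rw [falsify_of_notMem fun h => hEn h.2, hXc.1 E fun h => hEn h.2, hWU E hEU]
        · exact falsify_prec ⟨fun h => absurd h hEU, fun h => h.1⟩ (prec_of_ne_unk_imp (ih E))
      rw [(hU C hC.1).2] at this
      exact this.fls
    · rw [hXc.1 A fun h => hn h.2]
      exact .inr (hWU A hA).symm

theorem CorrectAt.congr (hB : TimeMonotone B) {n : ℕ} {X Y : PInterp V D}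
    (hX : CorrectAt B 𝒟 n X) (h : ∀ A : Atom V D, A.time ≤ n → X A = Y A) :
    CorrectAt B 𝒟 n Y := by
  intro A hA
  rw [← h A hA.le, ← hX A hA]
  exact wfm_congr_of_le hB (fun C _ hC => (h C hC).symm) hA.le

/-- Induction on time: `X` and the well-founded model solve the same local problem at `A.time`, with
equal surroundings by the induction hypothesis and by agreement on open atoms. -/
theorem eq_wfm_of_correctAt (hB : TimeMonotone B) {k : ℕ} {O X : PInterp V D}
    (hX : ∀ n ≤ k, CorrectAt B 𝒟 n X) (hO : ∀ A ∉ 𝒟, A.time ≤ k → X A = O A) {A : Atom V D}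
    (hA : A.time ≤ k) : X A = wfm B 𝒟 O A := by
  induction hn : A.time using Nat.strong_induction_on generalizing A with
  | _ n ih =>
  subst hn
  rw [← hX _ hA A rfl, ← correctAt_wfm hB O _ A rfl]
  refine wfm_congr_of_le hB (fun C hC hCA => ?_) le_rfl
  rcases hCA.lt_or_eq with h | h
  · exact ih _ h (h.le.trans hA) rfl
  · have : C ∉ 𝒟 := fun h' => hC ⟨h', h⟩
    rw [hO C this (hCA.trans hA), wfm_of_notMem hB this]

/-! ### Transport of local correctness along windows -/

theorem Window.wfm_prec (hB : TimeMonotone B) (hsh : ShiftInvariant B)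
    (h𝒟 : ∀ A : Atom V D, ∀ n, A.retime n ∈ 𝒟 ↔ A ∈ 𝒟) {X Y : PInterp V D} {n m : ℕ}
    (h : Window X n Y m) {A : Atom V D} (hA : A.time = n + 1) :
    (wfm B {A ∈ 𝒟 | A.time = n + 1} X A).Prec
      (wfm B {A ∈ 𝒟 | A.time = m + 1} Y (A.retime (m + 1))) := by
  classical
  set W := wfm B {A ∈ 𝒟 | A.time = m + 1} Y with hW
  have hWc : WFClosed B {A ∈ 𝒟 | A.time = m + 1} Y W := wfClosed_wfm hB Y
  -- Pull the local solution `W` back to time `n + 1` and keep `X` elsewhere. Once `N` is shown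
  -- closed for the problem at `n + 1`, minimality gives the claim; unfounded sets are tested
  -- through their images at time `m + 1`.
  let N : PInterp V D := fun C => if C.time = n + 1 then W (C.retime (m + 1)) else X C
  have hNn : ∀ C : Atom V D, C.time = n + 1 → N C = W (C.retime (m + 1)) := fun C hC => if_pos hC
  have hNX : ∀ C : Atom V D, C.time ≠ n + 1 → N C = X C := fun C hC => if_neg hC
  have hWY : ∀ C : Atom V D, C.time ≠ m + 1 → W C = Y C := fun C hC => hWc.1 C fun h => hC h.2
  have early : ∀ (C : Atom V D) (n : ℕ), (C.retime n).time ≠ n + 1 := fun C n => by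
    rcases C.time_retime with e | ⟨e, e'⟩
    · simp [e]
    · rw [e, e']; omega
  have hNW : Window N n W m := by
    refine ⟨fun C => by rw [hNX _ (early C n), hWY _ (early C m), h.1], fun C => ?_⟩
    rcases C.time_retime with e | ⟨e, e'⟩
    · rw [hNn _ (e _), Atom.retime_retime]
    · rw [hNX _ (by rw [e, e']; omega), hWY _ (by rw [e, e']; omega), h.2]
  have pos : ∀ C : Atom V D, C.time = n + 1 → (C.retime (m + 1)).time = m + 1 := fun C hC =>
    Atom.time_retime_of_pos (by omega) _
  rw [← hNn A hA]
  refine LTC.wfm_prec hB ⟨fun C hC => ?_, fun C hC hC' => ?_, fun U hU C hC => ?_⟩ A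
  · by_cases hCn : C.time = n + 1
    · rw [hNn C hCn, hWc.1 _ fun h' => hC ⟨(h𝒟 C _).1 h'.1, hCn⟩, ← h.2, ← hCn, C.retime_time]
    · exact hNX C hCn
  · rw [hNn C hC.2]
    rw [hsh N n W m hNW C hC.2] at hC'
    exact hWc.2.1 _ ⟨(h𝒟 C _).2 hC.1, pos C hC.2⟩ hC'
  · rw [hNn C (hU C hC).1.2]
    have inj : ∀ E E' : Atom V D, E.time = n + 1 → E'.time = n + 1 →
        E.retime (m + 1) = E'.retime (m + 1) → E = E' := fun E E' hE hE' e => by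
      rw [← E.retime_time, ← E'.retime_time, hE, hE', ← E.retime_retime (m + 1), e,
        Atom.retime_retime]
    have hfw : Window (falsify N U) n (falsify W (Atom.retime (m + 1) '' U)) m := by
      refine ⟨fun E => ?_, fun E => ?_⟩
      · rw [falsify_of_notMem fun h' => early E n (hU _ h').1.2, falsify_of_notMem, hNW.1]
        rintro ⟨E', hE', e⟩
        exact early E m (e ▸ pos E' (hU _ hE').1.2)
      · by_cases hE : E.retime (n + 1) ∈ U
        · rw [falsify_of_mem hE, falsify_of_mem (show E.retime (m + 1) ∈ Atom.retime (m + 1) '' U from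
            ⟨_, hE, E.retime_retime _ _⟩)]
        · rw [falsify_of_notMem hE, falsify_of_notMem, hNW.2]
          rintro ⟨E', hE', e⟩
          have ht' := (hU _ hE').1.2
          rcases E.time_retime with e' | ⟨e', e''⟩
          · refine hE (inj _ _ (e' _) ht' ?_ ▸ hE')
            rw [Atom.retime_retime, e]
          · have := pos E' ht'
            rw [e, e', e''] at this
            omega
    refine hWc.2.2 (Atom.retime (m + 1) '' U) ?_ _ ⟨C, hC, rfl⟩
    rintro _ ⟨E, hE, rfl⟩
    have hE' := hU E hE
    refine ⟨⟨(h𝒟 E _).2 hE'.1.1, pos E hE'.1.2⟩, ?_⟩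
    rw [← hsh _ _ _ _ hfw E hE'.1.2]
    exact hE'.2

theorem CorrectAt.of_window (hB : TimeMonotone B) (hsh : ShiftInvariant B)
    (h𝒟 : ∀ A : Atom V D, ∀ n, A.retime n ∈ 𝒟 ↔ A ∈ 𝒟) {X Y : PInterp V D} {n m : ℕ}
    (h : Window X n Y m) (hY : CorrectAt B 𝒟 (m + 1) Y) : CorrectAt B 𝒟 (n + 1) X := by
  intro A hA
  have hA' : (A.retime (m + 1)).time = m + 1 := Atom.time_retime_of_pos (by omega) _
  have back : (A.retime (m + 1)).retime (n + 1) = A := by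
    rw [Atom.retime_retime, ← hA, Atom.retime_time]
  have e := (h.wfm_prec hB hsh h𝒟 hA).antisymm (by
    simpa only [back] using h.symm.wfm_prec hB hsh h𝒟 hA')
  rw [e, hY _ hA', ← h.2, ← hA, Atom.retime_time]

end WellFounded

theorem isDefined_retime (Δ : Set (Rule V)) (A : Atom V D) (n : ℕ) :
    A.retime n ∈ {A | IsDefined Δ A} ↔ A ∈ {A | IsDefined Δ A} := by
  simp only [Set.mem_ofPred_eq, IsDefined, Atom.sym_retime]

/-! ### Sentences -/

theorem Formula.kl_congr {X Y : PInterp V D} {η η' : ℕ → ℕ} {n m : ℕ}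
    (hs : ∀ A : Atom V D, X (A.retime n) = Y (A.retime m)) {φ : Formula V}
    (hq : ∀ y, ¬ φ.QuantifiesTime y)
    (hd : ∀ t ∈ φ.timeTerms, ∀ A : Atom V D,
      X (A.retime (t.val η)) = Y (A.retime (t.val η')))
    (he : ∀ s ∈ φ.timeTerms, ∀ t ∈ φ.timeTerms, s.val η = t.val η ↔ s.val η' = t.val η')
    (ρ : ∀ τ, ℕ → D τ) : φ.kl X η ρ = φ.kl Y η' ρ :=
  (φ.kl_prec (precStatic_of_retime hs) hq
      (fun t ht => precAt_of_retime (hd t (φ.dynTimes_subset ht))) he ρ).antisymm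
    (φ.kl_prec (precStatic_of_retime fun A => (hs A).symm) hq
      (fun t ht => precAt_of_retime fun A => (hd t (φ.dynTimes_subset ht) A).symm)
      (fun s hs t ht => (he s hs t ht).symm) ρ)

/-- A false universal sentence has a false instance at some `n`, and the window there also occurs in
some `Y ∈ 𝒴`. Using a set `𝒴` lets the windows of a splice come from different sources. -/
theorem Formula.UniversalIn.kl_ne_fls {x : ℕ} {φ : Formula V} (hφ : φ.UniversalIn x)
    (ht : φ.timeTerms ⊆ {.var x, .succ (.var x)}) {X : PInterp V D} {𝒴 : Set (PInterp V D)}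
    (hX : ∀ n, ∃ Y ∈ 𝒴, ∃ m, Window X n Y m) {η : ℕ → ℕ}
    (h : ∀ Y ∈ 𝒴, ∀ ρ, φ.kl Y η ρ ≠ .fls) (ρ : ∀ τ, ℕ → D τ) : φ.kl X η ρ ≠ .fls := by
  induction hφ generalizing ρ with
  | under τ y φ hφ ih =>
    intro e
    obtain ⟨d, hd⟩ := TV.iInf_eq_fls.1 e
    refine ih ht (fun Y hY ρ hρ => ?_) _ hd
    -- Updating `y` to the value it already has changes nothing, so the hypothesis for all `ρ`
    -- passes to the subformula.
    refine h Y hY ρ (TV.iInf_eq_fls.2 ⟨ρ τ y, ?_⟩)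
    simpa [updateObj] using hρ
  | here φ hx =>
    intro e
    obtain ⟨n, hn⟩ := TV.iInf_eq_fls.1 e
    obtain ⟨Y, hY, m, hw⟩ := hX n
    refine h Y hY ρ (TV.iInf_eq_fls.2 ⟨m, ?_⟩)
    have ht' : φ.timeTerms ⊆ {.var x, .succ (.var x)} := Set.subset_union_right.trans ht
    rw [← hn]
    refine (Formula.kl_congr hw.1 (fun y hy => ?_) (fun t h => ?_) (fun s hs t h => ?_) ρ).symm
    · have := ht' hy.mem_timeTerms
      simp at this
      exact hx (this ▸ hy)
    · rcases ht' h with rfl | rfl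
      · simpa [TimeTerm.val] using hw.1
      · simpa [TimeTerm.val] using hw.2
    · rcases ht' hs with rfl | rfl <;> rcases ht' h with rfl | rfl <;> simp [TimeTerm.val]

theorem Formula.IsLTC.kl_ne_fls {φ : Formula V} (hφ : φ.IsLTC) {X Y : PInterp V D}
    {𝒴 : Set (PInterp V D)} (hX : ∀ n, ∃ Y ∈ 𝒴, ∃ m, Window X n Y m) (hY : Y ∈ 𝒴)
    (h₀ : ∀ A : Atom V D, X (A.retime 0) = Y (A.retime 0))
    (h : ∀ Y ∈ 𝒴, ∀ η ρ, φ.kl Y η ρ ≠ .fls) (η : ℕ → ℕ) (ρ : ∀ τ, ℕ → D τ) :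
    φ.kl X η ρ ≠ .fls := by
  have initial : φ.timeTerms ⊆ {.init} → φ.kl X η ρ ≠ .fls := fun ht => by
    rw [Formula.kl_congr (Y := Y) (η' := η) h₀ (fun y hy => ?_) (fun t h => ?_)
      (fun _ _ _ _ => .rfl) ρ]
    · exact h Y hY η ρ
    · simpa using ht hy.mem_timeTerms
    · rw [ht h]; exact h₀
  rcases hφ with e | e | ⟨x, e, hu⟩ | ⟨x, ⟨-, e⟩, hu⟩
  · exact initial (by simp [e])
  · exact initial e.subset
  · exact hu.kl_ne_fls (by rw [show φ.timeTerms = {.var x} from e]; simp) hX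
      (fun Y hY => h Y hY η) ρ
  · exact hu.kl_ne_fls e hX (fun Y hY => h Y hY η) ρ

theorem klSentence_eq_fls {X : PInterp V D} {φ : Formula V} :
    klSentence X φ = .fls ↔ ∃ η ρ, φ.kl X η ρ = .fls := by
  simp only [klSentence, TV.iInf_eq_fls]

/-! ### Kleene valuation of two-valued interpretations -/

theorem ObjTerm.klEq_toPartial (M : Interp V D) (η : ℕ → ℕ) (ρ : ∀ τ, ℕ → D τ) {τ : V.Ty}
    (a : ObjTerm V τ) (d : D τ) : a.klEq M.toPartial η ρ d = TV.ofProp (a.eval M η ρ = d) := by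
  induction a with
  | var τ x => rfl
  | sfun f args ih =>
    simp only [ObjTerm.klEq, ObjTerm.eval, Interp.toPartial, ih]
    refine TV.eq_ofProp ?_ ?_
    · simp only [TV.iSup_eq_tru, TV.inf_eq_tru, TV.iInf_eq_tru, TV.ofProp_eq_tru, ← funext_iff]
      simp
    · simp only [TV.iSup_eq_fls, TV.inf_eq_fls, TV.iInf_eq_fls, TV.ofProp_eq_fls, ← not_forall,
        ← funext_iff, ← imp_iff_not_or]
      simp
  | dfun f args t ih =>
    simp only [ObjTerm.klEq, ObjTerm.eval, Interp.toPartial, ih]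
    refine TV.eq_ofProp ?_ ?_
    · simp only [TV.iSup_eq_tru, TV.inf_eq_tru, TV.iInf_eq_tru, TV.ofProp_eq_tru, ← funext_iff]
      simp
    · simp only [TV.iSup_eq_fls, TV.inf_eq_fls, TV.iInf_eq_fls, TV.ofProp_eq_fls, ← not_forall,
        ← funext_iff, ← imp_iff_not_or]
      simp

theorem Formula.kl_toPartial (M : Interp V D) (φ : Formula V) (η : ℕ → ℕ) (ρ : ∀ τ, ℕ → D τ) :
    φ.kl M.toPartial η ρ = TV.ofProp (φ.Sat M η ρ) := by
  induction φ generalizing η ρ with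
  | top => exact (TV.ofProp_eq_tru.2 trivial).symm
  | spred p args =>
    simp only [Formula.kl, Formula.Sat, Interp.toPartial, ObjTerm.klEq_toPartial]
    refine TV.eq_ofProp ?_ ?_
    · simp only [TV.iSup_eq_tru, TV.inf_eq_tru, TV.iInf_eq_tru, TV.ofProp_eq_tru, ← funext_iff]
      simp
    · simp only [TV.iSup_eq_fls, TV.inf_eq_fls, TV.iInf_eq_fls, TV.ofProp_eq_fls, ← not_forall,
        ← funext_iff, ← imp_iff_not_or]
      simp
  | dpred p args t =>
    simp only [Formula.kl, Formula.Sat, Interp.toPartial, ObjTerm.klEq_toPartial]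
    refine TV.eq_ofProp ?_ ?_
    · simp only [TV.iSup_eq_tru, TV.inf_eq_tru, TV.iInf_eq_tru, TV.ofProp_eq_tru, ← funext_iff]
      simp
    · simp only [TV.iSup_eq_fls, TV.inf_eq_fls, TV.iInf_eq_fls, TV.ofProp_eq_fls, ← not_forall,
        ← funext_iff, ← imp_iff_not_or]
      simp
  | eqO τ a b =>
    simp only [Formula.kl, Formula.Sat, ObjTerm.klEq_toPartial]
    refine TV.eq_ofProp ?_ ?_
    · simp only [TV.iSup_eq_tru, TV.inf_eq_tru, TV.ofProp_eq_tru]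
      simp [eq_comm]
    · simp only [TV.iSup_eq_fls, TV.inf_eq_fls, TV.ofProp_eq_fls, ← imp_iff_not_or]
      simp [eq_comm]
  | eqT a b => rfl
  | neg φ ih =>
    simp only [Formula.kl, Formula.Sat, ih]
    exact TV.eq_ofProp (by simp [TV.neg_eq_tru, TV.ofProp_eq_fls])
      (by simp [TV.neg_eq_fls, TV.ofProp_eq_tru])
  | and φ ψ ih ih' =>
    simp only [Formula.kl, Formula.Sat, ih, ih']
    exact TV.eq_ofProp (by simp [TV.inf_eq_tru, TV.ofProp_eq_tru])
      (by simp [TV.inf_eq_fls, TV.ofProp_eq_fls, imp_iff_not_or])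
  | or φ ψ ih ih' =>
    simp only [Formula.kl, Formula.Sat, ih, ih']
    exact TV.eq_ofProp (by simp [TV.sup_eq_tru, TV.ofProp_eq_tru])
      (by simp [TV.sup_eq_fls, TV.ofProp_eq_fls])
  | allO τ x φ ih =>
    simp only [Formula.kl, Formula.Sat, ih]
    exact TV.eq_ofProp (by simp [TV.iInf_eq_tru, TV.ofProp_eq_tru])
      (by simp [TV.iInf_eq_fls, TV.ofProp_eq_fls])
  | exO τ x φ ih =>
    simp only [Formula.kl, Formula.Sat, ih]
    exact TV.eq_ofProp (by simp [TV.iSup_eq_tru, TV.ofProp_eq_tru])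
      (by simp [TV.iSup_eq_fls, TV.ofProp_eq_fls])
  | allT x φ ih =>
    simp only [Formula.kl, Formula.Sat, ih]
    exact TV.eq_ofProp (by simp [TV.iInf_eq_tru, TV.ofProp_eq_tru])
      (by simp [TV.iInf_eq_fls, TV.ofProp_eq_fls])
  | exT x φ ih =>
    simp only [Formula.kl, Formula.Sat, ih]
    exact TV.eq_ofProp (by simp [TV.iSup_eq_tru, TV.ofProp_eq_tru])
      (by simp [TV.iSup_eq_fls, TV.ofProp_eq_fls])

/-! ### Theories -/

/-- No sentence of `T` is false in `X`, and the definition of `T` is satisfied at the time points in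
`s`. -/
def Theory.Admits (T : Theory V) (X : PInterp V D) (s : Set ℕ) : Prop :=
  (∀ φ ∈ T.sentences, ∀ η ρ, φ.kl X η ρ ≠ .fls) ∧
    ∀ n ∈ s, CorrectAt (bodyVal T.rules) {A | IsDefined T.rules A} n X

theorem Theory.IsLTC.timeMonotone {T : Theory V} (hT : T.IsLTC) :
    TimeMonotone (bodyVal (D := D) T.rules) :=
  timeMonotone_bodyVal hT.2.1 hT.2.2

/-- Changes the past of `X₂` before time `k` into the past of `X₁` before time `k'`. -/
theorem Theory.IsLTC.admits_splice {T : Theory V} (hT : T.IsLTC) {k k' : ℕ}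
    {X X₁ X₂ : PInterp V D} (h₁ : ∀ n ≤ k', ∀ A : Atom V D, X (A.retime n) = X₁ (A.retime n))
    (h₂ : ∀ n, ∀ A : Atom V D, X (A.retime (k' + n)) = X₂ (A.retime (k + n))) {s s₂ : Set ℕ}
    (hs : ∀ n, k' + n + 1 ∈ s → k + n + 1 ∈ s₂) (hX₁ : T.Admits X₁ (Set.Iic k'))
    (hX₂ : T.Admits X₂ s₂) : T.Admits X s := by
  have hw : ∀ n, Window X (k' + n) X₂ (k + n) := fun n => ⟨h₂ n, h₂ (n + 1)⟩
  refine ⟨fun φ hφ => (hT.1 φ hφ).kl_ne_fls (𝒴 := {X₁, X₂}) (Y := X₁) (fun n => ?_) (.inl rfl)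
    (h₁ 0 (Nat.zero_le _)) ?_, fun n hn => ?_⟩
  · rcases lt_or_ge n k' with h | h
    · exact ⟨X₁, .inl rfl, n, h₁ n h.le, h₁ (n + 1) h⟩
    · obtain ⟨n, rfl⟩ := Nat.exists_eq_add_of_le h
      exact ⟨X₂, .inr rfl, _, hw n⟩
  · rintro Y (rfl | rfl)
    · exact hX₁.1 φ hφ
    · exact hX₂.1 φ hφ
  · rcases le_or_gt n k' with h | h
    · refine (hX₁.2 n h).congr hT.timeMonotone fun A hA => ?_
      rw [← A.retime_time, h₁ _ (hA.trans h)]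
    · obtain ⟨n, rfl⟩ := Nat.exists_eq_add_of_lt h
      exact (hX₂.2 _ (hs n hn)).of_window hT.timeMonotone
        (shiftInvariant_bodyVal hT.2.1 hT.2.2) (isDefined_retime _) (hw n)

theorem Theory.IsLTC.models_iff {T : Theory V} (hT : T.IsLTC) (ne : ∀ τ, Nonempty (D τ))
    (M : Interp V D) :
    (⟨D, ne, M⟩ : LTStructure V).Models T ↔ T.Admits M.toPartial Set.univ := by
  refine and_congr ?_ ?_
  · simp [Formula.kl_toPartial, TV.ofProp_eq_fls]
  · rw [Interp.SatDef, isWFModel_iff hT.timeMonotone]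
    refine ⟨fun h n _ => ?_, fun h => funext fun A => ?_⟩
    · rw [h]
      exact correctAt_wfm hT.timeMonotone _ n
    · exact eq_wfm_of_correctAt hT.timeMonotone (k := A.time) (fun n _ => h n trivial)
        (fun _ _ _ => rfl) le_rfl

theorem klTheory_eq_fls_iff {X : PInterp V D} {T : Theory V} : klTheory X T = .fls ↔
    (∃ φ ∈ T.sentences, klSentence X φ = .fls) ∨ klDef X T.rules = .fls := by
  rw [klTheory]
  split_ifs with h h'
  · refine iff_of_false (by simp) ?_
    rintro (⟨φ, hφ, e⟩ | e)
    · simp [h.1 φ hφ] at e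
    · simp [h.2] at e
  · exact iff_of_true rfl h'
  · exact iff_of_false (by simp) h'

theorem klDef_eq_fls_iff {X : PInterp V D} {Δ : Set (Rule V)} : klDef X Δ = .fls ↔
    ¬ DefTrue Δ X ∧ DefFalse Δ X := by
  rw [klDef]
  split_ifs <;> simp_all

/-- For an interpretation that is two-valued exactly up to time `k`, the definition is not false
when it is satisfied up to time `k`. -/
theorem Theory.IsLTC.klTheory_ne_fls_iff {T : Theory V} (hT : T.IsLTC) {k : ℕ}
    {X : PInterp V D} {G : Interp V D} (hk : ∀ A, X A = .unk ↔ k < A.time)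
    (hG : ∀ A, (X A).Prec (G.toPartial A)) :
    klTheory X T ≠ .fls ↔ T.Admits X (Set.Iic k) := by
  have hB := hT.timeMonotone (D := D)
  have two : ∀ A : Atom V D, A.time ≤ k → X A ≠ .unk := fun A hA h => hA.not_gt ((hk A).1 h)
  have hGX : ∀ A : Atom V D, A.time ≤ k → X A = G.toPartial A := fun A hA =>
    ((hG A).eq_of_ne_unk (two A hA)).symm
  rw [Ne, klTheory_eq_fls_iff, not_or, Theory.Admits]
  refine and_congr (by simp [klSentence_eq_fls]) ?_
  rw [klDef_eq_fls_iff, not_and_or, not_not]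
  set 𝒟 : Set (Atom V D) := {A | IsDefined T.rules A} with h𝒟
  constructor
  · rintro (h | h) n hn
    · rw [(isWFModel_iff hB _ _).1 h.2]
      exact correctAt_wfm hB _ n
    · refine (correctAt_wfm (𝒟 := 𝒟) hB G.toPartial n).congr hB fun A hA => ?_
      have hAk : A.time ≤ k := hA.trans hn
      by_cases hD : A ∈ 𝒟
      · by_contra hne
        refine h ⟨A, hD, two A hAk, fun G' hG' W hW e => hne ?_⟩
        rw [(isWFModel_iff hB _ _).1 hW] at e
        rw [← e]
        refine wfm_congr_of_le hB (fun C hC hCk => ?_) hAk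
        rw [← hGX C hCk, (hG' C hC).eq_of_ne_unk (two C hCk)]
      · rw [wfm_of_notMem hB hD, hGX A hAk]
  · refine fun h => .inr fun ⟨A, hA, hne, hf⟩ => ?_
    have hAk : A.time ≤ k := not_lt.1 fun h => hne ((hk A).2 h)
    refine hf G (fun C _ => hG C) _ ((isWFModel_iff hB _ _).2 rfl) ?_
    exact (eq_wfm_of_correctAt hB (fun n hn => h n hn) (fun C _ hC => hGX C hC) hAk).symm

/-! ### Chains -/

/-- The partial interpretation with the given static symbols and states; nothing is known about the
time points without a state. -/
noncomputable def ofSlices (st : StatInterp V D) (f : ℕ → Option (DynInterp V D)) : PInterp V D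
  | .spred p d => TV.ofProp (st.pred p d)
  | .dpred p d n => (f n).elim .unk fun s => TV.ofProp (s.pred p d)
  | .sfun g d e => TV.ofProp (st.func g d = e)
  | .dfun g d n e => (f n).elim .unk fun s => TV.ofProp (s.func g d = e)

theorem ofSlices_retime (st : StatInterp V D) {f g : ℕ → Option (DynInterp V D)} {n m : ℕ}
    (h : f n = g m) (A : Atom V D) :
    ofSlices st f (A.retime n) = ofSlices st g (A.retime m) := by
  cases A <;> simp [ofSlices, Atom.retime, h]

/-- The interpretation of the dynamic symbols at time `n`. -/
def Interp.slice (M : Interp V D) (n : ℕ) : DynInterp V D :=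
  ⟨fun p d => M.dynPred p d n, fun f d => M.dynFun f d n⟩

theorem Interp.toPartial_eq (M : Interp V D) :
    M.toPartial = ofSlices M.stat fun n => some (M.slice n) := by
  funext A; cases A <;> rfl

/-- The states of a chain, continued by `none`. -/
def chainSlices {k : ℕ} (dyn : Fin (k + 1) → DynInterp V D) (n : ℕ) : Option (DynInterp V D) :=
  if h : n < k + 1 then some (dyn ⟨n, h⟩) else none

theorem chainSlices_snoc_of_le {k n : ℕ} (dyn : Fin (k + 1) → DynInterp V D) (s : DynInterp V D)
    (h : n ≤ k) : chainSlices (Fin.snoc dyn s : Fin (k + 2) → DynInterp V D) n =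
      chainSlices dyn n := by
  have h' : n < k + 1 := by omega
  rw [chainSlices, chainSlices, dif_pos h', dif_pos (by omega)]
  exact congrArg some (Fin.snoc_castSucc (α := fun _ => DynInterp V D) s dyn ⟨n, h'⟩)

theorem chainSlices_snoc_succ {k : ℕ} (dyn : Fin (k + 1) → DynInterp V D) (s : DynInterp V D) :
    chainSlices (Fin.snoc dyn s : Fin (k + 2) → DynInterp V D) (k + 1) = some s := by
  rw [chainSlices, dif_pos (by omega)]
  exact congrArg some (Fin.snoc_last (α := fun _ => DynInterp V D) s dyn)

theorem chainSlices_of_lt {k n : ℕ} (dyn : Fin (k + 1) → DynInterp V D) (h : k < n) :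
    chainSlices dyn n = none := dif_neg (by omega)

theorem chainSlices_last {k : ℕ} (dyn : Fin (k + 1) → DynInterp V D) :
    chainSlices dyn k = some (dyn (Fin.last k)) := dif_pos (by omega)

/-- From the joint on, both extended chains read alike: the common last state, the new state, then
nothing known. -/
theorem chainSlices_snoc_shift {k k' : ℕ} {dyn : Fin (k + 1) → DynInterp V D}
    {dyn' : Fin (k' + 1) → DynInterp V D} (h : dyn (Fin.last k) = dyn' (Fin.last k'))
    (s : DynInterp V D) (n : ℕ) :
    chainSlices (Fin.snoc dyn' s : Fin (k' + 2) → DynInterp V D) (k' + n) =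
      chainSlices (Fin.snoc dyn s : Fin (k + 2) → DynInterp V D) (k + n) := by
  match n with
  | 0 =>
    rw [add_zero, add_zero, chainSlices_snoc_of_le _ _ le_rfl, chainSlices_snoc_of_le _ _ le_rfl,
      chainSlices_last, chainSlices_last, h]
  | 1 => rw [chainSlices_snoc_succ, chainSlices_snoc_succ]
  | n + 2 => rw [chainSlices_of_lt _ (by omega), chainSlices_of_lt _ (by omega)]

variable {k k' : ℕ} {ne : ∀ τ, Nonempty (D τ)} {st : StatInterp V D}
  {dyn : Fin (k + 1) → DynInterp V D} {dyn' : Fin (k' + 1) → DynInterp V D}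

theorem Chain.toPartial_eq : (⟨D, ne, st, dyn⟩ : Chain V k).toPartial =
    ofSlices st (chainSlices dyn) := by
  funext A
  cases A with
  | spred | sfun => rfl
  | dpred p d n => by_cases h : n < k + 1 <;> simp [Chain.toPartial, ofSlices, chainSlices, h]
  | dfun p d n => by_cases h : n < k + 1 <;> simp [Chain.toPartial, ofSlices, chainSlices, h]

theorem Theory.IsLTC.weaklyCompatible_iff {T : Theory V} (hT : T.IsLTC) :
    WeaklyCompatible T (⟨D, ne, st, dyn⟩ : Chain V k) ↔
      T.Admits (ofSlices st (chainSlices dyn)) (Set.Iic k) := by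
  rw [WeaklyCompatible, Chain.toPartial_eq]
  -- A two-valued completion is needed as a witness; repeating the last state forever provides one.
  let G : Interp V D := ⟨st, fun p d n => (dyn ⟨min n k, by omega⟩).pred p d,
    fun f d n => (dyn ⟨min n k, by omega⟩).func f d⟩
  have unk : ∀ A, ofSlices st (chainSlices dyn) A = .unk ↔ k < A.time := by
    intro A
    cases A with
    | spred | sfun => exact iff_of_false (TV.ofProp_ne_unk _) (Nat.not_lt_zero _)
    | dpred p d n | dfun p d n =>
      by_cases h : n < k + 1
      · simp [ofSlices, chainSlices, Atom.time, h, TV.ofProp_ne_unk]; omega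
      · simp [ofSlices, chainSlices, Atom.time, h]; omega
  refine hT.klTheory_ne_fls_iff (G := G) unk fun A => ?_
  by_cases hA : k < A.time
  · exact .inl ((unk A).2 hA)
  · refine .of_eq ?_
    rw [G.toPartial_eq, ← A.retime_time]
    refine ofSlices_retime st ?_ A
    have h : A.time < k + 1 := by omega
    rw [chainSlices, dif_pos h]
    simp only [G, Interp.slice, Nat.min_eq_left (Nat.lt_succ_iff.1 h)]

/-! ### Chains and successors over fixed domains -/

theorem compatible_iff {T : Theory V} : Compatible T (⟨D, ne, st, dyn⟩ : Chain V k) ↔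
    ∃ N : Interp V D, N.stat = st ∧ (∀ j : Fin (k + 1), N.slice j = dyn j) ∧
      (⟨D, ne, N⟩ : LTStructure V).Models T := by
  constructor
  · rintro ⟨⟨D', ne', N⟩, hE, hM⟩
    have h₀ := hE 0
    simp only [LTStructure.state, Chain.state, State.mk.injEq] at h₀
    obtain ⟨rfl, h₁, -⟩ := h₀
    refine ⟨N, eq_of_heq h₁, fun j => ?_, hM⟩
    have h := hE j
    simp only [LTStructure.state, Chain.state, State.mk.injEq, true_and] at h
    exact eq_of_heq h.2
  · rintro ⟨N, rfl, h, hM⟩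
    refine ⟨⟨D, ne, N⟩, fun j => ?_, hM⟩
    simp only [LTStructure.state, Chain.state, ← h]
    rfl

theorem isDirectExtension_iff {J : Chain V (k + 1)} {S : State V} :
    IsDirectExtension J (⟨D, ne, st, dyn⟩ : Chain V k) S ↔
      ∃ s, S = ⟨D, ne, st, s⟩ ∧ J = ⟨D, ne, st, Fin.snoc dyn s⟩ := by
  constructor
  · rintro ⟨h, rfl⟩
    obtain ⟨D', ne', st', dyn''⟩ := J
    have h₀ := h 0
    simp only [Chain.state, State.mk.injEq] at h₀
    obtain ⟨rfl, h₁, -⟩ := h₀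
    obtain rfl := eq_of_heq h₁
    refine ⟨dyn'' (Fin.last _), rfl, ?_⟩
    congr
    funext j
    refine Fin.lastCases ?_ (fun j => ?_) j
    · simp
    · have h := h j
      simp only [Chain.state, State.mk.injEq, true_and, heq_eq_eq] at h
      simpa using h
  · rintro ⟨s, rfl, rfl⟩
    exact ⟨fun j => by simp [Chain.state], by simp [Chain.state]⟩

theorem isSuccessor_iff {T : Theory V} {S : State V} :
    IsSuccessor T (⟨D, ne, st, dyn⟩ : Chain V k) S ↔
      ∃ s, S = ⟨D, ne, st, s⟩ ∧
        Compatible T (⟨D, ne, st, Fin.snoc dyn s⟩ : Chain V (k + 1)) := by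
  simp only [IsSuccessor, isDirectExtension_iff]
  exact ⟨fun ⟨_, ⟨s, hS, hJ⟩, h⟩ => ⟨s, hS, hJ ▸ h⟩, fun ⟨s, hS, h⟩ => ⟨_, ⟨s, hS, rfl⟩, h⟩⟩

theorem isWeakSuccessor_iff {T : Theory V} {S : State V} :
    IsWeakSuccessor T (⟨D, ne, st, dyn⟩ : Chain V k) S ↔
      ∃ s, S = ⟨D, ne, st, s⟩ ∧
        WeaklyCompatible T (⟨D, ne, st, Fin.snoc dyn s⟩ : Chain V (k + 1)) := by
  simp only [IsWeakSuccessor, isDirectExtension_iff]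
  exact ⟨fun ⟨_, ⟨s, hS, hJ⟩, h⟩ => ⟨s, hS, hJ ▸ h⟩, fun ⟨s, hS, h⟩ => ⟨_, ⟨s, hS, rfl⟩, h⟩⟩

/-! ### The two Markov properties -/

theorem Theory.IsLTC.weaklyCompatible_snoc {T : Theory V} (hT : T.IsLTC)
    (hlast : dyn (Fin.last k) = dyn' (Fin.last k')) {s : DynInterp V D}
    (h' : WeaklyCompatible T (⟨D, ne, st, dyn'⟩ : Chain V k'))
    (h : WeaklyCompatible T (⟨D, ne, st, Fin.snoc dyn s⟩ : Chain V (k + 1))) :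
    WeaklyCompatible T (⟨D, ne, st, Fin.snoc dyn' s⟩ : Chain V (k' + 1)) := by
  rw [hT.weaklyCompatible_iff] at *
  refine hT.admits_splice (k := k) (fun n hn => ofSlices_retime st ?_)
    (fun n => ofSlices_retime st ?_) (fun n hn => ?_) h' h
  · exact chainSlices_snoc_of_le dyn' s hn
  · exact chainSlices_snoc_shift hlast s n
  · simp only [Set.mem_Iic] at hn ⊢; omega

theorem Theory.IsLTC.compatible_snoc {T : Theory V} (hT : T.IsLTC)
    (hlast : dyn (Fin.last k) = dyn' (Fin.last k')) {s : DynInterp V D}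
    (h' : Compatible T (⟨D, ne, st, dyn'⟩ : Chain V k'))
    (h : Compatible T (⟨D, ne, st, Fin.snoc dyn s⟩ : Chain V (k + 1))) :
    Compatible T (⟨D, ne, st, Fin.snoc dyn' s⟩ : Chain V (k' + 1)) := by
  rw [compatible_iff] at *
  obtain ⟨M, rfl, hM, hMT⟩ := h'
  obtain ⟨N, hN₀, hN, hNT⟩ := h
  have hk : N.slice k = M.slice k' := by
    have h₁ := hN (Fin.last k).castSucc
    have h₂ := hM (Fin.last k')
    rw [Fin.snoc_castSucc, hlast] at h₁
    exact h₁.trans h₂.symm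
  have hk1 : N.slice (k + 1) = s := by
    have h₁ := hN (Fin.last (k + 1))
    rwa [Fin.snoc_last] at h₁
  -- Follow `M` up to the joint `k'`, then `N` after its time `k`. The subtraction is used only for
  -- `n > k'`, so it never truncates; `hk` makes the pieces match at the joint.
  let f : ℕ → DynInterp V D := fun n => if n ≤ k' then M.slice n else N.slice (n - k' + k)
  let L : Interp V D := ⟨M.stat, fun p d n => (f n).pred p d, fun g d n => (f n).func g d⟩
  have hL₁ : ∀ n ≤ k', L.slice n = M.slice n := fun n hn => by
    change f n = _
    exact if_pos hn
  have hL₂ : ∀ n, L.slice (k' + n) = N.slice (k + n) := fun n => by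
    cases n with
    | zero => exact (hL₁ k' le_rfl).trans hk.symm
    | succ n =>
      change f _ = _
      simp only [f]
      rw [if_neg (by omega)]
      congr 1
      omega
  refine ⟨L, rfl, fun j => ?_, ?_⟩
  · refine Fin.lastCases ?_ (fun j => ?_) j
    · rw [Fin.snoc_last]
      exact (hL₂ 1).trans hk1
    · rw [Fin.snoc_castSucc]
      exact (hL₁ j (by omega)).trans (hM j)
  · rw [hT.models_iff] at *
    rw [Interp.toPartial_eq] at *
    rw [hN₀] at hNT
    exact hT.admits_splice (k := k)
      (fun n hn => ofSlices_retime M.stat (congrArg some (hL₁ n hn)))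
      (fun n => ofSlices_retime M.stat (congrArg some (hL₂ n))) (s₂ := Set.univ) (fun _ _ => trivial)
      ⟨hMT.1, fun n _ => hMT.2 n trivial⟩ hNT

/-- Equality of states includes equality of domains; eliminating it once lets all other arguments
compare states over a single `D` without casts. -/
theorem Chain.exists_eq_of_state_eq {I : Chain.{u, v} V k} {I' : Chain.{u, v} V k'}
    (h : I.state (Fin.last k) = I'.state (Fin.last k')) :
    ∃ (D : V.Ty → Type v) (ne : ∀ τ, Nonempty (D τ)) (st : StatInterp V D)
      (dyn : Fin (k + 1) → DynInterp V D) (dyn' : Fin (k' + 1) → DynInterp V D),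
      I = ⟨D, ne, st, dyn⟩ ∧ I' = ⟨D, ne, st, dyn'⟩ ∧
        dyn (Fin.last k) = dyn' (Fin.last k') := by
  obtain ⟨D, ne, st, dyn⟩ := I
  obtain ⟨D', ne', st', dyn'⟩ := I'
  simp only [Chain.state, State.mk.injEq] at h
  obtain ⟨rfl, h₁, h₂⟩ := h
  obtain rfl := eq_of_heq h₁
  exact ⟨D, ne, st, dyn, dyn', rfl, rfl, eq_of_heq h₂⟩

theorem Theory.IsLTC.markovProperty {T : Theory V} (hT : T.IsLTC) :
    MarkovProperty.{u, v} T := by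
  intro k k' I I' hI hI' hlast S
  obtain ⟨D, ne, st, dyn, dyn', rfl, rfl, h⟩ := Chain.exists_eq_of_state_eq hlast
  rw [isSuccessor_iff, isSuccessor_iff]
  exact exists_congr fun s => and_congr_right fun _ =>
    ⟨hT.compatible_snoc h hI', hT.compatible_snoc h.symm hI⟩

theorem Theory.IsLTC.weakMarkovProperty {T : Theory V} (hT : T.IsLTC) :
    WeakMarkovProperty.{u, v} T := by
  intro k k' I I' hI hI' hlast S
  obtain ⟨D, ne, st, dyn, dyn', rfl, rfl, h⟩ := Chain.exists_eq_of_state_eq hlast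
  rw [isWeakSuccessor_iff, isWeakSuccessor_iff]
  exact exists_congr fun s => and_congr_right fun _ =>
    ⟨hT.weaklyCompatible_snoc h hI', hT.weaklyCompatible_snoc h.symm hI⟩

end LTC

theorem corollary1 {V : LTC.Vocabulary.{u}} (T : LTC.Theory V) (hT : T.IsLTC) :
    LTC.MarkovProperty.{u, v} T ∧ LTC.WeakMarkovProperty.{u, v} T :=
  ⟨hT.markovProperty, hT.weakMarkovProperty⟩
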